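/- **Theorem.** Let $n\ge 2$ and let $p,q,\theta,\delta,s_0,s_1$ be real numbers with $1\le p\le q<p+1$, $\theta\ge 0$, $\delta\ge 1$, $s_0,s_1>\frac np$. If $p<n$, put $p^*=\frac{np}{n-p}$ and assume $\frac qp<1+\frac1n$ and $\theta,\delta<p^*$. If $p\ge n$, assume $s_0,s_1>1$ and let $p^*$ be any fixed real number with $$p^*>\max\left\{\tfrac{p}{p-q+1},\ \theta,\ \delta,\ \tfrac{ps_1}{s_1-1},\ \tfrac{ps_0}{s_0-1}\right\}.$$ Let $c_1,c_2,c_3,c_4,M>0$, let $\Omega\subseteq\mathbb R^n$ be open, and let $a:\Omega\times\mathbb R\times\mathbb R^n\to\mathbb R^n$ and $b:\Omega\times\mathbb R\times\mathbb R^n\to\mathbb R$ be Carathéodory functions (measurable in $x$ for all $(u,\xi)$, continuous in $(u,\xi)$ for a.e. $x$) such that for a.e. $x\in\Omega$ and all $u\in\mathbb R$, $\xi\in\mathbb R^n$ $$\langle a(x,u,\xi),\xi\rangle\ \ge\ c_1|\xi|^p-c_2|u|^\theta-b_1(x),$$ $$|a(x,u,\xi)|\ \le\ c_3|\xi|^{q-1}+c_4|u|^{(q-1)\frac{2}{q-p+2}}+b_1(x),$$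 $$|b(x,u,\xi)|\ \le\ M\left(1+|\xi|^2\right)^{\frac{p+q-2}{4}}+M|u|^{\delta-1}+b_0(x),$$ where $b_0,b_1\ge 0$ a.e., $b_0\in L^{s_0}_{\mathrm{loc}}(\Omega)$ and $b_1\in L^{s_1}_{\mathrm{loc}}(\Omega)$ (with the convention $t^0=1$ for all $t\ge 0$). Let $u\in W^{1,q}_{\mathrm{loc}}(\Omega)$ be a weak solution of $\sum_{i=1}^n\frac{\partial}{\partial x_i}a^i(x,u,Du)=b(x,u,Du)$ in $\Omega$, i.e. for all $\varphi\in W^{1,q}(\Omega)$ with compact support in $\Omega$ the function $\langle a(x,u,Du),D\varphi\rangle+b(x,u,Du)\varphi$ is integrable in $\Omega$ and $$\int_\Omega\left\{\langle a(x,u,Du),D\varphi\rangle+b(x,u,Du)\,\varphi\right\}dx=0 .$$ Put $$\sigma:=p^*-\max\left\{\tfrac{p}{p-q+1},\ \tfrac{p^*}{s_1}+1,\ \tfrac{p^*}{s_0}+1,\ \theta,\ \delta\right\}.$$ Then $\sigma>0$ and $u\in L^\infty_{\mathrm{loc}}(\Omega)$. Moreover, whenever $0<R_0\le1$ and $\overline{B_{R_0}(x_0)}\subseteq\Omega$,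 for every $0<r\le R_0$ one has $u\in L^{p^*}(B_r(x_0))$ and $$\|u\|_{L^\infty(B_{r/2}(x_0))}\le\frac{c}{r^{\frac{p}{\sigma(p-q+1)}}}\left(1+\|u\|_{L^{p^*}(B_r(x_0))}\right)^{\frac{p^*-p}{\sigma}},$$ where the constant $c>0$ depends only on $n,p,q,\theta,\delta,s_0,s_1,p^*,c_1,\dots,c_4,M$ and on (upper bounds for) $\|b_0\|_{L^{s_0}(B_{R_0}(x_0))}$ and $\|b_1\|_{L^{s_1}(B_{R_0}(x_0))}$; in particular it is independent of $u$. -/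

import Mathlib

open MeasureTheory
open scoped ContDiff ENNReal

noncomputable section

/-- `G` is the weak gradient of `u` on `Ω`: both are locally integrable in `Ω` and
`∫_Ω u ∂ᵢφ = - ∫_Ω Gᵢ φ` for all `φ ∈ C_c^∞(Ω)` and all `i`. -/
structure HasWeakGradient {n : ℕ} (Ω : Set (EuclideanSpace ℝ (Fin n)))
    (u : EuclideanSpace ℝ (Fin n) → ℝ)
    (G : EuclideanSpace ℝ (Fin n) → EuclideanSpace ℝ (Fin n)) : Prop where
  locallyIntegrable_fun : LocallyIntegrableOn u Ω volume
  locallyIntegrable_grad : LocallyIntegrableOn G Ω volume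
  integral_eq : ∀ φ : EuclideanSpace ℝ (Fin n) → ℝ, ContDiff ℝ ∞ φ → HasCompactSupport φ →
    tsupport φ ⊆ Ω → ∀ i : Fin n,
      ∫ x in Ω, u x * fderiv ℝ φ x (EuclideanSpace.single i 1) = - ∫ x in Ω, G x i * φ x

/-- `f ∈ L^s_loc(Ω)`: `f ∈ L^s(K)` for every compact `K ⊆ Ω`. -/
def MemLpLoc {n : ℕ} {F : Type*} [NormedAddCommGroup F]
    (Ω : Set (EuclideanSpace ℝ (Fin n))) (s : ℝ≥0∞) (f : EuclideanSpace ℝ (Fin n) → F) : Prop :=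
  ∀ K : Set (EuclideanSpace ℝ (Fin n)), IsCompact K → K ⊆ Ω → MemLp f s (volume.restrict K)

/-- `u ∈ W^{1,q}(Ω)`, with weak gradient `G`. -/
def MemW1 {n : ℕ} (Ω : Set (EuclideanSpace ℝ (Fin n))) (q : ℝ)
    (u : EuclideanSpace ℝ (Fin n) → ℝ)
    (G : EuclideanSpace ℝ (Fin n) → EuclideanSpace ℝ (Fin n)) : Prop :=
  HasWeakGradient Ω u G ∧ MemLp u (ENNReal.ofReal q) (volume.restrict Ω) ∧
    MemLp G (ENNReal.ofReal q) (volume.restrict Ω)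

/-- `u ∈ W^{1,q}_loc(Ω)`, with weak gradient `G`. -/
def MemW1Loc {n : ℕ} (Ω : Set (EuclideanSpace ℝ (Fin n))) (q : ℝ)
    (u : EuclideanSpace ℝ (Fin n) → ℝ)
    (G : EuclideanSpace ℝ (Fin n) → EuclideanSpace ℝ (Fin n)) : Prop :=
  HasWeakGradient Ω u G ∧ MemLpLoc Ω (ENNReal.ofReal q) u ∧ MemLpLoc Ω (ENNReal.ofReal q) G

/-- `f(x, u, ξ)` is a Carathéodory function on `Ω × ℝ × ℝⁿ`: (Lebesgue) measurable in `x ∈ Ω` for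
all `(u, ξ)`, and continuous in `(u, ξ)` for a.e. `x ∈ Ω`. -/
def IsCaratheodory {n : ℕ} {F : Type*} [TopologicalSpace F] [MeasurableSpace F]
    (Ω : Set (EuclideanSpace ℝ (Fin n)))
    (f : EuclideanSpace ℝ (Fin n) → ℝ → EuclideanSpace ℝ (Fin n) → F) : Prop :=
  (∀ u ξ, AEMeasurable (fun x => f x u ξ) (volume.restrict Ω)) ∧
    ∀ᵐ x ∂(volume.restrict Ω),
      Continuous fun z : ℝ × EuclideanSpace ℝ (Fin n) => f x z.1 z.2

/-- `u ∈ W^{1,q}_loc(Ω)` is a weak solution of `div a(x, u, Du) = b(x, u, Du)` in `Ω`: for every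
`φ ∈ W^{1,q}(Ω)` whose (essential) support is contained in a compact subset of `Ω`, the function
`⟨a(x, u, Du), Dφ⟩ + b(x, u, Du) φ` is integrable in `Ω`, with integral zero. Here `G = Du` and
`H = Dφ`. -/
def IsWeakSolution {n : ℕ} (Ω : Set (EuclideanSpace ℝ (Fin n))) (q : ℝ)
    (a : EuclideanSpace ℝ (Fin n) → ℝ → EuclideanSpace ℝ (Fin n) → EuclideanSpace ℝ (Fin n))
    (b : EuclideanSpace ℝ (Fin n) → ℝ → EuclideanSpace ℝ (Fin n) → ℝ)
    (u : EuclideanSpace ℝ (Fin n) → ℝ) : Prop :=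
  ∃ G : EuclideanSpace ℝ (Fin n) → EuclideanSpace ℝ (Fin n), MemW1Loc Ω q u G ∧
    ∀ (φ : EuclideanSpace ℝ (Fin n) → ℝ)
      (H : EuclideanSpace ℝ (Fin n) → EuclideanSpace ℝ (Fin n)), MemW1 Ω q φ H →
      (∃ K : Set (EuclideanSpace ℝ (Fin n)), IsCompact K ∧ K ⊆ Ω ∧
        ∀ᵐ x ∂(volume.restrict Ω), x ∉ K → φ x = 0) →
      IntegrableOn (fun x => inner ℝ (a x (u x) (G x)) (H x) + b x (u x) (G x) * φ x) Ω volume ∧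
      ∫ x in Ω, (inner ℝ (a x (u x) (G x)) (H x) + b x (u x) (G x) * φ x) = 0

/-- The conditions on the exponents. If `p < n`, `pstar` is the Sobolev exponent `np/(n-p)`;
if `p ≥ n`, it is any sufficiently large real number. -/
structure AdmissibleExponents (n : ℕ) (p q θ δ s₀ s₁ pstar : ℝ) : Prop where
  one_le_p : 1 ≤ p
  p_le_q : p ≤ q
  q_lt : q < p + 1
  θ_nonneg : 0 ≤ θ
  one_le_δ : 1 ≤ δ
  lt_s₀ : n / p < s₀
  lt_s₁ : n / p < s₁
  of_lt : p < n → q / p < 1 + 1 / n ∧ pstar = n * p / (n - p) ∧ θ < pstar ∧ δ < pstar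
  of_ge : n ≤ p → 1 < s₀ ∧ 1 < s₁ ∧ p / (p - q + 1) < pstar ∧ θ < pstar ∧ δ < pstar ∧
    p * s₁ / (s₁ - 1) < pstar ∧ p * s₀ / (s₀ - 1) < pstar

/-- `σ = p* - max {p/(p-q+1), p*/s₁ + 1, p*/s₀ + 1, θ, δ}`. -/
def sigmaExponent (p q θ δ s₀ s₁ pstar : ℝ) : ℝ :=
  pstar - max (p / (p - q + 1)) (max (pstar / s₁ + 1) (max (pstar / s₀ + 1) (max θ δ)))

/-- The coercivity condition on `a` and the growth conditions on `a` and `b`. -/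
structure StructureConditions {n : ℕ} (Ω : Set (EuclideanSpace ℝ (Fin n)))
    (p q θ δ s₀ s₁ c₁ c₂ c₃ c₄ M : ℝ)
    (a : EuclideanSpace ℝ (Fin n) → ℝ → EuclideanSpace ℝ (Fin n) → EuclideanSpace ℝ (Fin n))
    (b : EuclideanSpace ℝ (Fin n) → ℝ → EuclideanSpace ℝ (Fin n) → ℝ)
    (b₀ b₁ : EuclideanSpace ℝ (Fin n) → ℝ) : Prop where
  caratheodory_a : IsCaratheodory Ω a
  caratheodory_b : IsCaratheodory Ω b
  b₀_nonneg : ∀ᵐ x ∂(volume.restrict Ω), 0 ≤ b₀ x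
  b₁_nonneg : ∀ᵐ x ∂(volume.restrict Ω), 0 ≤ b₁ x
  b₀_memLp : MemLpLoc Ω (ENNReal.ofReal s₀) b₀
  b₁_memLp : MemLpLoc Ω (ENNReal.ofReal s₁) b₁
  coercivity : ∀ᵐ x ∂(volume.restrict Ω), ∀ (u : ℝ) (ξ : EuclideanSpace ℝ (Fin n)),
    c₁ * ‖ξ‖ ^ p - c₂ * |u| ^ θ - b₁ x ≤ inner ℝ (a x u ξ) ξ
  growth_a : ∀ᵐ x ∂(volume.restrict Ω), ∀ (u : ℝ) (ξ : EuclideanSpace ℝ (Fin n)),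
    ‖a x u ξ‖ ≤ c₃ * ‖ξ‖ ^ (q - 1) + c₄ * |u| ^ ((q - 1) * (2 / (q - p + 2))) + b₁ x
  growth_b : ∀ᵐ x ∂(volume.restrict Ω), ∀ (u : ℝ) (ξ : EuclideanSpace ℝ (Fin n)),
    |b x u ξ| ≤ M * (1 + ‖ξ‖ ^ 2) ^ ((p + q - 2) / 4) + M * |u| ^ (δ - 1) + b₀ x

end

/-! The proof is a De Giorgi iteration on the mass `Y(k, ρ)` of `|u| ^ pstar` over the part of `B_ρ`
where `|u| > k`. The equation is tested with `φ = η ^ N * g(u)`, where `η` is a cutoff and `g =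
rampPrimitive k k'` is a C¹ truncation whose derivative `m = ramp k k'` vanishes for `|u| ≤ k`.
Since `|g(u)| ≤ m |u|`, every term carries the same weight `m` as the coercive term `m η ^ N |Du| ^
p`, so Young's inequality absorbs the gradient terms pointwise (`exists_absorption_const`,
`exists_pointwise_const`). This works in the space `W^{1,q}` of the solution itself; the gap between
`p` and `q` only shows in the Young exponent `τ = p / (p - q + 1)`, and for `p < n` the assumption
`q / p < 1 + 1 / n` says exactly `τ < pstar`.

Sobolev's inequality for `φ` then gives `exists_energy_const`: `Y(k', ρ') ^ (p / pstar)` is bounded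
by `(ρ - ρ') ^ (-τ)`, times a factor depending on the level gap, times the integral of `|u| ^ lam +
|u| (b₀ + b₁)` over `|u| > k`, with `lam = pstar - σ`. By Hölder (`lintegral_superlevelTerm_le`)
this integral is at most `k ^ (-σ) * (Y + N₀ * Y ^ (1 - 1 / s₀) + N₁ * Y ^ (1 - 1 / s₁))`. Both
powers `1 - 1 / sᵢ` exceed `p / pstar`, so the recursion is superlinear.

Along levels rising from `K` to `2K` and radii falling from `r` to `r / 2`, the masses decay
geometrically (`le_geometric_of_superlinear`) once `K ^ σ` is a large multiple of `r ^ (-τ) * (1 +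
‖u‖) ^ (pstar - p)`, the norm being that of `L^{pstar}(B_r)`. Hence `|u| ≤ 2K` on `B_{r/2}`, and
solving for `K` gives the exponents of the theorem (`exists_local_bound_const`).

The calculus of weak gradients needed for this (product rule, chain rule, Sobolev inequality) is
obtained by mollification. -/

section

open Filter Topology Metric Set

/-! ### Mollification. -/

/-- A sequence of smooth bump functions shrinking to the origin. -/
noncomputable def mollifier (E : Type*) (j : ℕ) [NormedAddCommGroup E] : ContDiffBump (0 : E) where
  rIn := 1 / 2 * (1 / ((j : ℝ) + 1))
  rOut := 1 / ((j : ℝ) + 1)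
  rIn_pos := by positivity
  rIn_lt_rOut := by
    have : (0 : ℝ) < 1 / ((j : ℝ) + 1) := by positivity
    linarith

section Mollify

variable {E F : Type*} [NormedAddCommGroup E] [NormedSpace ℝ E] [FiniteDimensional ℝ E]
  [MeasurableSpace E] [BorelSpace E] (μ : Measure E) [μ.IsAddHaarMeasure]
  [NormedAddCommGroup F] [NormedSpace ℝ F]

/-- The regularization of `f` by convolution with the `j`-th mollifier. -/
noncomputable def mollify (j : ℕ) (f : E → F) : E → F :=
  convolution ((mollifier E j).normed μ) f (ContinuousLinearMap.lsmul ℝ ℝ) μ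

variable {μ}

set_option linter.unusedSectionVars false

theorem mollify_apply (j : ℕ) (f : E → F) (x : E) :
    mollify μ j f x = ∫ t, (mollifier E j).normed μ t • f (x - t) ∂μ := rfl

theorem tendsto_rOut_mollifier : Tendsto (fun j => (mollifier E j).rOut) atTop (𝓝 0) :=
  tendsto_one_div_add_atTop_nhds_zero_nat

theorem contDiff_mollify {f : E → F} (hf : LocallyIntegrable f μ) (j : ℕ) :
    ContDiff ℝ ∞ (mollify μ j f) := by
  have := (mollifier E j).hasCompactSupport_normed (μ := μ)
  exact this.contDiff_convolution_left _ (mollifier E j).contDiff_normed hf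

theorem hasCompactSupport_mollify {f : E → F} (hf : HasCompactSupport f) (j : ℕ) :
    HasCompactSupport (mollify μ j f) :=
  HasCompactSupport.convolution _ ((mollifier E j).hasCompactSupport_normed (μ := μ)) hf

theorem ae_tendsto_mollify [CompleteSpace F] {f : E → F} (hf : LocallyIntegrable f μ) :
    ∀ᵐ x ∂μ, Tendsto (fun j => mollify μ j f x) atTop (𝓝 (f x)) := by
  -- Lebesgue differentiation needs a bounded ratio of outer to inner radius; here `rOut = 2 * rIn`.
  refine ContDiffBump.ae_convolution_tendsto_right_of_locallyIntegrable (K := 2)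
    tendsto_rOut_mollifier (Eventually.of_forall fun j => ?_) hf
  change 1 / ((j : ℝ) + 1) ≤ 2 * (1 / 2 * (1 / ((j : ℝ) + 1)))
  linarith

theorem mollify_sub {f g : E → F} (hf : LocallyIntegrable f μ) (hg : LocallyIntegrable g μ)
    (j : ℕ) (x : E) : mollify μ j (f - g) x = mollify μ j f x - mollify μ j g x := by
  have h1 : ∀ {f : E → F}, LocallyIntegrable f μ →
      Integrable (fun t => (mollifier E j).normed μ t • f (x - t)) μ := fun hf =>
    ((mollifier E j).hasCompactSupport_normed (μ := μ)).convolutionExists_left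
      (ContinuousLinearMap.lsmul ℝ ℝ) (mollifier E j).continuous_normed hf x
  simp only [mollify_apply, Pi.sub_apply, smul_sub]
  exact integral_sub (h1 hf) (h1 hg)

theorem isProbabilityMeasure_withDensity_mollifier (j : ℕ) :
    IsProbabilityMeasure (μ.withDensity fun t => ENNReal.ofReal ((mollifier E j).normed μ t)) := by
  constructor
  rw [withDensity_apply _ MeasurableSet.univ, Measure.restrict_univ,
    ← ofReal_integral_eq_lintegral_ofReal (mollifier E j).integrable_normed
      (Eventually.of_forall (mollifier E j).nonneg_normed), (mollifier E j).integral_normed,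
    ENNReal.ofReal_one]

/-- Mollification does not increase the `L^p` norm. -/
theorem lintegral_mollify_rpow_le {f : E → F} (hf : AEStronglyMeasurable f μ) {p : ℝ} (hp : 1 ≤ p)
    (j : ℕ) : ∫⁻ x, ‖mollify μ j f x‖ₑ ^ p ∂μ ≤ ∫⁻ x, ‖f x‖ₑ ^ p ∂μ := by
  -- The kernel defines a probability measure `ν`, so monotonicity of `L^p` norms in `p` plays the
  -- role of Jensen's inequality; Tonelli and translation invariance do the rest.
  set ν := μ.withDensity fun t => ENNReal.ofReal ((mollifier E j).normed μ t) with hν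
  have : IsProbabilityMeasure ν := isProbabilityMeasure_withDensity_mollifier j
  have hρ : Measurable fun t => ENNReal.ofReal ((mollifier E j).normed μ t) :=
    (mollifier E j).continuous_normed.measurable.ennreal_ofReal
  have hac : ν ≪ μ := withDensity_absolutelyContinuous _ _
  have hsub : AEStronglyMeasurable (fun z : E × E => f (z.1 - z.2)) (μ.prod ν) := by
    have h1 : Measure.QuasiMeasurePreserving (fun z : E × E => z.1 - z.2) (μ.prod μ) μ :=
      quasiMeasurePreserving_sub μ μ
    exact (hf.comp_quasiMeasurePreserving h1).mono_ac (Measure.AbsolutelyContinuous.rfl.prod hac)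
  have key : ∀ x, AEStronglyMeasurable (fun t => f (x - t)) ν →
      ‖mollify μ j f x‖ₑ ^ p ≤ ∫⁻ t, ‖f (x - t)‖ₑ ^ p ∂ν := by
    intro x hx
    have h1 : ‖mollify μ j f x‖ₑ ≤ ∫⁻ t, ‖f (x - t)‖ₑ ∂ν := by
      rw [mollify_apply]
      refine (enorm_integral_le_lintegral_enorm _).trans_eq ?_
      rw [hν, lintegral_withDensity_eq_lintegral_mul_non_measurable _ hρ
        (Eventually.of_forall fun _ => ENNReal.ofReal_lt_top)]
      refine lintegral_congr fun t => ?_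
      rw [enorm_smul, Real.enorm_eq_ofReal ((mollifier E j).nonneg_normed t)]
      rfl
    have h2 := eLpNorm_le_eLpNorm_of_exponent_le (μ := ν) (p := 1) (q := ENNReal.ofReal p)
      (f := fun t => f (x - t)) (by simpa using hp) hx
    rw [eLpNorm_one_eq_lintegral_enorm, eLpNorm_eq_lintegral_rpow_enorm_toReal (by simp; linarith)
      ENNReal.ofReal_ne_top, ENNReal.toReal_ofReal (by linarith), one_div] at h2
    exact (ENNReal.le_rpow_inv_iff (by linarith)).1 (h1.trans h2)
  calc ∫⁻ x, ‖mollify μ j f x‖ₑ ^ p ∂μ ≤ ∫⁻ x, ∫⁻ t, ‖f (x - t)‖ₑ ^ p ∂ν ∂μ := by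
        refine lintegral_mono_ae ?_
        filter_upwards [hsub.prodMk_left] with x hx using key x hx
    _ = ∫⁻ t, ∫⁻ x, ‖f (x - t)‖ₑ ^ p ∂μ ∂ν :=
        lintegral_lintegral_swap (hsub.enorm.pow_const p)
    _ = ∫⁻ t, ∫⁻ x, ‖f x‖ₑ ^ p ∂μ ∂ν := by
        refine lintegral_congr fun t => ?_
        exact lintegral_sub_right_eq_self (fun x => ‖f x‖ₑ ^ p) t
    _ = ∫⁻ x, ‖f x‖ₑ ^ p ∂μ := by simp

theorem integrable_mollify {f : E → F} (hf : Integrable f μ) (j : ℕ) :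
    Integrable (mollify μ j f) μ := by
  refine ⟨(contDiff_mollify hf.locallyIntegrable j).continuous.aestronglyMeasurable, ?_⟩
  have := lintegral_mollify_rpow_le hf.1 le_rfl j
  simp only [ENNReal.rpow_one] at this
  exact this.trans_lt hf.2

/-- Mollifications of an integrable function converge to it in `L¹`. -/
theorem tendsto_lintegral_mollify_sub [CompleteSpace F] {f : E → F} (hf : Integrable f μ) :
    Tendsto (fun j => ∫⁻ x, ‖mollify μ j f x - f x‖ₑ ∂μ) atTop (𝓝 0) := by
  -- For continuous `g` with compact support, dominated convergence applies: all kernels live in the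
  -- unit ball, so the differences vanish off the 1-thickening of the support.
  have hcont : ∀ g : E → F, HasCompactSupport g → Continuous g →
      Tendsto (fun j => ∫⁻ x, ‖mollify μ j g x - g x‖ₑ ∂μ) atTop (𝓝 0) := by
    intro g hg hgc
    set K := cthickening 1 (tsupport g) with hK
    have hKc : IsCompact K := hg.isCompact.cthickening
    obtain ⟨C, hC⟩ := hgc.bounded_above_of_compact_support hg
    have hgi : LocallyIntegrable g μ := hgc.locallyIntegrable
    have hbd : ∀ j x, ‖mollify μ j g x - g x‖ₑ ≤ K.indicator (fun _ => ENNReal.ofReal (2 * C)) x := by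
      intro j x
      by_cases hx : x ∈ K
      · rw [indicator_of_mem hx, ← ofReal_norm]
        refine ENNReal.ofReal_le_ofReal ?_
        rw [← dist_eq_norm]
        refine ContDiffBump.dist_normed_convolution_le hgc.aestronglyMeasurable fun y _ => ?_
        rw [dist_eq_norm]
        exact (norm_sub_le _ _).trans (by linarith [hC x, hC y])
      · rw [indicator_of_notMem hx]
        have h0 : ∀ y ∈ ball x (mollifier E j).rOut, g y = 0 := by
          intro y hy
          by_contra hne
          have hy' : y ∈ tsupport g := subset_tsupport g hne
          refine hx (mem_cthickening_of_dist_le x y 1 _ hy' ?_)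
          rw [mem_ball'] at hy
          refine hy.le.trans ?_
          change 1 / ((j : ℝ) + 1) ≤ 1
          rw [div_le_one (by positivity)]
          linarith [(j.cast_nonneg : (0 : ℝ) ≤ j)]
        have hx0 : g x = 0 := h0 x (mem_ball_self (mollifier E j).rOut_pos)
        have : mollify μ j g x = g x :=
          ContDiffBump.normed_convolution_eq_right fun y hy => by rw [h0 y hy, hx0]
        simp [this]
    have := tendsto_lintegral_of_dominated_convergence' (μ := μ)
      (F := fun j x => ‖mollify μ j g x - g x‖ₑ) (f := fun _ => 0) _
      (fun j => ((contDiff_mollify hgi j).continuous.sub hgc).enorm.aemeasurable)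
      (fun j => Eventually.of_forall (hbd j)) ?_ ?_
    · simpa using this
    · rw [lintegral_indicator hKc.measurableSet, setLIntegral_const]
      exact ENNReal.mul_ne_top ENNReal.ofReal_ne_top hKc.measure_lt_top.ne
    · filter_upwards [ae_tendsto_mollify hgi] with x hx
      simpa using ((hx.sub_const (g x)).enorm)
  rw [ENNReal.tendsto_nhds_zero]
  intro ε hε
  rcases eq_or_ne ε ∞ with rfl | hε'
  · simp
  have hε3 : ε / 3 ≠ 0 := (ENNReal.div_pos hε.ne' (by simp)).ne'
  -- Density of such `g` in `L¹`, together with the contraction property of mollification.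
  obtain ⟨g, hg, hfg, hgc, hgi⟩ := hf.exists_hasCompactSupport_lintegral_sub_le hε3
  filter_upwards [(ENNReal.tendsto_nhds_zero.1 (hcont g hg hgc)) (ε / 3)
    (pos_iff_ne_zero.2 hε3)] with j hj
  have h1 : ∫⁻ x, ‖mollify μ j (f - g) x‖ₑ ∂μ ≤ ε / 3 := by
    have := lintegral_mollify_rpow_le (hf.sub hgi).1 le_rfl j
    simp only [ENNReal.rpow_one] at this
    exact this.trans hfg
  have hm : ∀ {h : E → F}, Integrable h μ → AEMeasurable (fun x => ‖h x‖ₑ) μ := fun h => h.1.enorm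
  calc ∫⁻ x, ‖mollify μ j f x - f x‖ₑ ∂μ
      ≤ ∫⁻ x, (‖mollify μ j (f - g) x‖ₑ + ‖mollify μ j g x - g x‖ₑ + ‖(f - g) x‖ₑ) ∂μ := by
        refine lintegral_mono fun x => ?_
        have : mollify μ j f x - f x
            = mollify μ j (f - g) x + (mollify μ j g x - g x) - (f - g) x := by
          rw [mollify_sub hf.locallyIntegrable hgi.locallyIntegrable, Pi.sub_apply]; abel
        rw [this]
        exact (enorm_sub_le).trans (by gcongr; exact enorm_add_le _ _)
    _ = ∫⁻ x, ‖mollify μ j (f - g) x‖ₑ ∂μ + ∫⁻ x, ‖mollify μ j g x - g x‖ₑ ∂μ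
          + ∫⁻ x, ‖(f - g) x‖ₑ ∂μ := by
        rw [lintegral_add_right' _ (hm (hf.sub hgi)),
          lintegral_add_left' (hm (integrable_mollify (hf.sub hgi) j))]
    _ ≤ ε / 3 + ε / 3 + ε / 3 := by gcongr; exact hfg
    _ = ε := ENNReal.add_thirds ε

end Mollify

end

/-! ### Product and chain rules for weak gradients. -/

section

open Filter Topology Metric Set

variable {n : ℕ} {Ω : Set (EuclideanSpace ℝ (Fin n))} {u : EuclideanSpace ℝ (Fin n) → ℝ}
  {G : EuclideanSpace ℝ (Fin n) → EuclideanSpace ℝ (Fin n)}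

theorem gradient_apply (ζ : EuclideanSpace ℝ (Fin n) → ℝ) (x : EuclideanSpace ℝ (Fin n))
    (i : Fin n) : gradient ζ x i = fderiv ℝ ζ x (EuclideanSpace.single i 1) := by
  rw [← inner_gradient_left, EuclideanSpace.inner_single_right]
  simp

theorem norm_gradient (ζ : EuclideanSpace ℝ (Fin n) → ℝ) (x : EuclideanSpace ℝ (Fin n)) :
    ‖gradient ζ x‖ = ‖fderiv ℝ ζ x‖ := by
  rw [← toDual_gradient, LinearIsometryEquiv.norm_map]

theorem continuous_gradient {ζ : EuclideanSpace ℝ (Fin n) → ℝ} (hζ : ContDiff ℝ ∞ ζ) :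
    Continuous (gradient ζ) :=
  (InnerProductSpace.toDual ℝ _).symm.continuous.comp (hζ.continuous_fderiv (by simp))

theorem gradient_eq_zero_of_notMem_tsupport {ζ : EuclideanSpace ℝ (Fin n) → ℝ}
    {x : EuclideanSpace ℝ (Fin n)} (hx : x ∉ tsupport ζ) : gradient ζ x = 0 := by
  have : fderiv ℝ ζ x = 0 := by
    by_contra h
    exact hx (support_fderiv_subset ℝ h)
  rw [gradient, this, map_zero]

theorem hasCompactSupport_gradient {ζ : EuclideanSpace ℝ (Fin n) → ℝ} (hζ : HasCompactSupport ζ) :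
    HasCompactSupport (gradient ζ) :=
  HasCompactSupport.intro hζ.isCompact fun _ hx => gradient_eq_zero_of_notMem_tsupport hx

theorem tsupport_gradient_subset (ζ : EuclideanSpace ℝ (Fin n) → ℝ) :
    tsupport (gradient ζ) ⊆ tsupport ζ := by
  refine closure_minimal (fun x hx => ?_) (isClosed_tsupport ζ)
  by_contra h
  exact hx (gradient_eq_zero_of_notMem_tsupport h)

/-- A function that is locally integrable in `Ω`, times a continuous function with compact support
in `Ω`, is integrable. -/
theorem integrable_smul_of_locallyIntegrableOn {X F : Type*} [TopologicalSpace X] [T2Space X]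
    [TopologicalSpace.PseudoMetrizableSpace X] [SecondCountableTopology X]
    [MeasurableSpace X] [OpensMeasurableSpace X] {μ : Measure X} [NormedAddCommGroup F]
    [NormedSpace ℝ F] {U : Set X} {f : X → F} (hf : LocallyIntegrableOn f U μ) {ψ : X → ℝ}
    (hψ : Continuous ψ) (hc : HasCompactSupport ψ) (hs : tsupport ψ ⊆ U) :
    Integrable (fun x => ψ x • f x) μ := by
  have h1 : IntegrableOn (fun x => ψ x • f x) (tsupport ψ) μ := by
    obtain ⟨C, hC⟩ := hψ.bounded_above_of_compact_support hc
    exact (hf.integrableOn_compact_subset hs hc).bdd_smul C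
      hψ.aestronglyMeasurable (Eventually.of_forall hC)
  rwa [integrableOn_iff_integrable_of_support_subset] at h1
  intro x hx
  refine subset_tsupport _ ?_
  intro h0
  simp [h0] at hx

theorem HasWeakGradient.mono (h : HasWeakGradient univ u G) :
    HasWeakGradient Ω u G := by
  refine ⟨h.1.mono_set (subset_univ _), h.2.mono_set (subset_univ _), fun φ hφ hc hs i => ?_⟩
  have h1 := h.3 φ hφ hc (subset_univ _) i
  rw [Measure.restrict_univ] at h1
  rw [setIntegral_eq_integral_of_forall_compl_eq_zero, h1,
    setIntegral_eq_integral_of_forall_compl_eq_zero]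
  · intro x hx
    rw [image_eq_zero_of_notMem_tsupport fun h => hx (hs h), mul_zero]
  · intro x hx
    rw [← gradient_apply, gradient_eq_zero_of_notMem_tsupport fun h => hx (hs h)]
    simp

/-- The product rule for a weakly differentiable function and a test function. -/
theorem HasWeakGradient.smul_testFunction (h : HasWeakGradient Ω u G)
    {ζ : EuclideanSpace ℝ (Fin n) → ℝ} (hζ : ContDiff ℝ ∞ ζ) (hc : HasCompactSupport ζ)
    (hs : tsupport ζ ⊆ Ω) :
    Integrable (fun x => ζ x * u x) ∧ Integrable (fun x => ζ x • G x + u x • gradient ζ x) ∧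
    HasWeakGradient univ (fun x => ζ x * u x) (fun x => ζ x • G x + u x • gradient ζ x) := by
  have hI : ∀ (ψ : EuclideanSpace ℝ (Fin n) → ℝ), Continuous ψ → HasCompactSupport ψ →
      tsupport ψ ⊆ Ω → Integrable (fun x => ψ x * u x) := fun ψ h1 h2 h3 => by
    simpa using integrable_smul_of_locallyIntegrableOn h.1 h1 h2 h3
  have hI1 : Integrable (fun x => ζ x * u x) := hI ζ hζ.continuous hc hs
  have hG : ∀ (ψ : EuclideanSpace ℝ (Fin n) → ℝ), Continuous ψ → HasCompactSupport ψ →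
      tsupport ψ ⊆ Ω → Integrable (fun x => ψ x • G x) := fun ψ h1 h2 h3 =>
    integrable_smul_of_locallyIntegrableOn h.2 h1 h2 h3
  have hI2 : Integrable (fun x => u x • gradient ζ x) := by
    have h1 : AEStronglyMeasurable (fun x => u x • gradient ζ x) (volume.restrict (tsupport ζ)) :=
      ((h.1.integrableOn_compact_subset hs hc).1).smul
        (continuous_gradient hζ).aestronglyMeasurable
    have h2 : IntegrableOn (fun x => u x • gradient ζ x) (tsupport ζ) := by
      obtain ⟨C, hC⟩ := (continuous_gradient hζ).bounded_above_of_compact_support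
        (hasCompactSupport_gradient hc)
      exact (h.1.integrableOn_compact_subset hs hc).smul_bdd C
        (continuous_gradient hζ).aestronglyMeasurable (Eventually.of_forall hC)
    rwa [integrableOn_iff_integrable_of_support_subset] at h2
    intro x hx
    by_contra hx'
    simp [gradient_eq_zero_of_notMem_tsupport hx'] at hx
  have hI3 := (hG ζ hζ.continuous hc hs).add hI2
  refine ⟨hI1, hI3, hI1.locallyIntegrable.locallyIntegrableOn _,
    hI3.locallyIntegrable.locallyIntegrableOn _, fun φ hφ hφc _ i => ?_⟩
  rw [Measure.restrict_univ]
  have hsub : tsupport (fun x => ζ x * φ x) ⊆ tsupport ζ := tsupport_mul_subset_left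
  -- The test function `ζ * φ` is supported in `Ω` even if `φ` is not; expanding its derivative
  -- gives the product rule on the whole space.
  have h1 := h.3 (fun x => ζ x * φ x) (hζ.mul hφ) (hc.mul_right) (hsub.trans hs) i
  have hd : ∀ x, fderiv ℝ (fun x => ζ x * φ x) x (EuclideanSpace.single i 1)
      = ζ x * fderiv ℝ φ x (EuclideanSpace.single i 1) + φ x * gradient ζ x i := by
    intro x
    rw [fderiv_fun_mul ((hζ.differentiable (by simp)) x) ((hφ.differentiable (by simp)) x),
      gradient_apply]
    simp
  simp only [hd] at h1
  rw [setIntegral_eq_integral_of_forall_compl_eq_zero,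
    setIntegral_eq_integral_of_forall_compl_eq_zero] at h1
  rotate_left
  · intro x hx
    rw [image_eq_zero_of_notMem_tsupport fun h => hx (hs h)]; simp
  · intro x hx
    rw [image_eq_zero_of_notMem_tsupport fun h => hx (hs h),
      gradient_eq_zero_of_notMem_tsupport fun h => hx (hs h)]; simp
  have cφ : Continuous fun x => fderiv ℝ φ x (EuclideanSpace.single i 1) :=
    (hφ.continuous_fderiv (by simp)).clm_apply continuous_const
  have cζ : Continuous fun x => gradient ζ x i :=
    (EuclideanSpace.proj (𝕜 := ℝ) i).continuous.comp (continuous_gradient hζ)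
  have e1 : Integrable fun x => (ζ x * u x) * fderiv ℝ φ x (EuclideanSpace.single i 1) := by
    have := hI (fun x => ζ x * fderiv ℝ φ x (EuclideanSpace.single i 1))
      (hζ.continuous.mul cφ) hc.mul_right (tsupport_mul_subset_left.trans hs)
    refine this.congr (Eventually.of_forall fun x => ?_)
    simp only; ring
  have e2 : Integrable fun x => φ x * gradient ζ x i * u x := by
    have hcz : HasCompactSupport fun x => gradient ζ x i :=
      (hasCompactSupport_gradient hc).comp_left (g := fun y : EuclideanSpace ℝ (Fin n) => y i)
        (by simp)
    refine hI _ (hφ.continuous.mul cζ) hφc.mul_right ?_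
    refine (tsupport_mul_subset_right.trans ?_).trans hs
    refine (closure_mono ?_).trans (tsupport_gradient_subset ζ)
    intro x hx h0
    simp [h0] at hx
  have e3 : Integrable fun x => G x i * (ζ x * φ x) := by
    have := (EuclideanSpace.proj (𝕜 := ℝ) i).integrable_comp
      (hG (fun x => ζ x * φ x) (hζ.mul hφ).continuous hc.mul_right (hsub.trans hs))
    refine this.congr (Eventually.of_forall fun x => ?_)
    simp; ring
  have l1 : ∫ x, u x * (ζ x * fderiv ℝ φ x (EuclideanSpace.single i 1) + φ x * gradient ζ x i)
      = (∫ x, (ζ x * u x) * fderiv ℝ φ x (EuclideanSpace.single i 1))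
        + ∫ x, φ x * gradient ζ x i * u x := by
    rw [← integral_add e1 e2]
    congr 1; ext x; ring
  have l2 : ∫ x, (ζ x • G x + u x • gradient ζ x) i * φ x
      = (∫ x, G x i * (ζ x * φ x)) + ∫ x, φ x * gradient ζ x i * u x := by
    rw [← integral_add e3 e2]
    congr 1; ext x; simp; ring
  rw [l2]
  linarith

/-- The derivative can be put on the kernel, and `t ↦ ρ (x - t)` is itself an admissible test
function, so the definition of the weak gradient moves it to `v`; the reflection accounts for the
sign. -/
theorem fderiv_mollify {v : EuclideanSpace ℝ (Fin n) → ℝ}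
    {H : EuclideanSpace ℝ (Fin n) → EuclideanSpace ℝ (Fin n)} (h : HasWeakGradient univ v H)
    (j : ℕ) (x : EuclideanSpace ℝ (Fin n)) (i : Fin n) :
    fderiv ℝ (mollify volume j v) x (EuclideanSpace.single i 1) = mollify volume j H x i := by
  have hv : LocallyIntegrable v := locallyIntegrableOn_univ.1 h.1
  have hH : LocallyIntegrable H := locallyIntegrableOn_univ.1 h.2
  set ρ := (mollifier (EuclideanSpace ℝ (Fin n)) j).normed volume with hρ
  have hρc : HasCompactSupport ρ :=
    (mollifier (EuclideanSpace ℝ (Fin n)) j).hasCompactSupport_normed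
  have hρs : ∀ {m : ℕ∞}, ContDiff ℝ m ρ := (mollifier _ j).contDiff_normed
  have e0 : mollify volume j v
      = convolution v ρ (ContinuousLinearMap.lsmul ℝ ℝ).flip volume := by
    rw [convolution_flip]; rfl
  rw [e0, (hρc.hasFDerivAt_convolution_right _ hv (hρs (m := 1)) x).fderiv,
    convolution_precompR_apply _ hv (hρc.fderiv ℝ) ((hρs (m := 1)).continuous_fderiv (by simp))]
  have e1 : mollify volume j H x = ∫ t, ρ (x - t) • H t := by
    exact convolution_eq_swap (f := ρ) (g := H) (μ := volume) (x := x)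
      (L := ContinuousLinearMap.lsmul ℝ ℝ)
  let φ : EuclideanSpace ℝ (Fin n) → ℝ := fun t => ρ (x - t)
  have hφ : ContDiff ℝ ∞ φ := (hρs (m := ⊤)).comp (contDiff_const.sub contDiff_id)
  have hφc : HasCompactSupport φ := hρc.comp_homeomorph (Homeomorph.subLeft x)
  have hρH : Integrable fun t => ρ (x - t) • H t :=
    hH.integrable_smul_left_of_hasCompactSupport hφ.continuous hφc
  have e2 : (∫ t, ρ (x - t) • H t) i = ∫ t, H t i * φ t := by
    have := (EuclideanSpace.proj (𝕜 := ℝ) i).integral_comp_comm hρH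
    refine this.symm.trans ?_
    congr 1; ext t; exact mul_comm _ _
  have e3 := h.3 φ hφ hφc (subset_univ _) i
  rw [Measure.restrict_univ] at e3
  rw [e1, e2, ← neg_eq_iff_eq_neg.2 e3, convolution_def, ← integral_neg]
  congr 1; ext t
  have hd : fderiv ℝ φ t = - fderiv ℝ ρ (x - t) := by
    have h1 : HasFDerivAt ρ (fderiv ℝ ρ (x - t)) (x - t) :=
      (((hρs (m := 1)).differentiable (by simp)) _).hasFDerivAt
    have h2 : HasFDerivAt (fun t => x - t) (-ContinuousLinearMap.id ℝ _) t :=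
      (hasFDerivAt_id t).const_sub x
    have := (h1.comp t h2).fderiv
    rw [show φ = ρ ∘ fun t => x - t from rfl, this]
    ext; simp
  rw [hd]
  simp [mul_comm]

theorem norm_fderiv_mollify {v : EuclideanSpace ℝ (Fin n) → ℝ}
    {H : EuclideanSpace ℝ (Fin n) → EuclideanSpace ℝ (Fin n)} (h : HasWeakGradient univ v H)
    (j : ℕ) (x : EuclideanSpace ℝ (Fin n)) :
    ‖fderiv ℝ (mollify volume j v) x‖ = ‖mollify volume j H x‖ := by
  rw [← norm_gradient]
  congr 1
  ext i
  rw [gradient_apply, fderiv_mollify h]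

/-- The chain rule for weakly differentiable functions. -/
theorem HasWeakGradient.comp {v : EuclideanSpace ℝ (Fin n) → ℝ}
    {H : EuclideanSpace ℝ (Fin n) → EuclideanSpace ℝ (Fin n)} (h : HasWeakGradient univ v H)
    (hv : Integrable v) (hH : Integrable H) {g g' : ℝ → ℝ} (hg : ∀ t, HasDerivAt g (g' t) t)
    (hg' : Continuous g') {L : ℝ} (hL : ∀ t, |g' t| ≤ L) (hg0 : g 0 = 0) :
    HasWeakGradient univ (fun x => g (v x)) (fun x => g' (v x) • H x) := by
  have hgc : Continuous g := continuous_iff_continuousAt.2 fun t => (hg t).continuousAt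
  have hL0 : 0 ≤ L := (abs_nonneg _).trans (hL 0)
  have hlip : ∀ s t, |g s - g t| ≤ L * |s - t| := fun s t =>
    convex_univ.norm_image_sub_le_of_norm_hasDerivWithin_le (f := g) (f' := g')
      (fun x _ => (hg x).hasDerivWithinAt) (fun x _ => hL x) (mem_univ t) (mem_univ s)
  have hgv : Integrable fun x => g (v x) := by
    refine (hv.norm.const_mul L).mono' (hgc.comp_aestronglyMeasurable hv.1)
      (Eventually.of_forall fun x => ?_)
    simpa [hg0] using hlip (v x) 0
  have hgH : Integrable fun x => g' (v x) • H x :=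
    hH.bdd_smul L (hg'.comp_aestronglyMeasurable hv.1) (Eventually.of_forall fun x => hL _)
  refine ⟨hgv.locallyIntegrable.locallyIntegrableOn _,
    hgH.locallyIntegrable.locallyIntegrableOn _, fun φ hφ hφc _ i => ?_⟩
  rw [Measure.restrict_univ]
  have cφ : Continuous fun x => fderiv ℝ φ x (EuclideanSpace.single i 1) :=
    (hφ.continuous_fderiv (by simp)).clm_apply continuous_const
  obtain ⟨C, hC⟩ := hφ.continuous.bounded_above_of_compact_support hφc
  obtain ⟨D, hD⟩ := cφ.bounded_above_of_compact_support
    ((hφc.fderiv ℝ).comp_left (g := fun T : EuclideanSpace ℝ (Fin n) →L[ℝ] ℝ =>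
      T (EuclideanSpace.single i 1)) (by simp))
  have hC0 : 0 ≤ C := (norm_nonneg _).trans (hC 0)
  have hD0 : 0 ≤ D := (norm_nonneg _).trans (hD 0)
  have hsm : ∀ j, ContDiff ℝ ∞ (mollify volume j v) := contDiff_mollify hv.locallyIntegrable
  have hsm' : ∀ j, ContDiff ℝ ∞ (mollify volume j H) := contDiff_mollify hH.locallyIntegrable
  -- For mollifications the chain rule is classical; `t1` and `t2` pass to the limit on both sides.
  have hparts : ∀ j, ∫ x, g (mollify volume j v x) * fderiv ℝ φ x (EuclideanSpace.single i 1)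
      = - ∫ x, (g' (mollify volume j v x) * mollify volume j H x i) * φ x := by
    intro j
    have hdv : ∀ x, HasFDerivAt (fun x => g (mollify volume j v x))
        (g' (mollify volume j v x) • fderiv ℝ (mollify volume j v) x) x := fun x =>
      (hg _).comp_hasFDerivAt x (((hsm j).differentiable (by simp)) x).hasFDerivAt
    have c1 : Continuous fun x => g (mollify volume j v x) := hgc.comp (hsm j).continuous
    have c2 : Continuous fun x => g' (mollify volume j v x) * mollify volume j H x i :=
      (hg'.comp (hsm j).continuous).mul
        ((EuclideanSpace.proj (𝕜 := ℝ) i).continuous.comp (hsm' j).continuous)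
    have hφc' : HasCompactSupport fun x => fderiv ℝ φ x (EuclideanSpace.single i 1) :=
      (hφc.fderiv ℝ).comp_left (g := fun T : EuclideanSpace ℝ (Fin n) →L[ℝ] ℝ =>
        T (EuclideanSpace.single i 1)) (by simp)
    have := integral_mul_fderiv_eq_neg_fderiv_mul_of_integrable (μ := volume)
      (f := fun x => g (mollify volume j v x)) (g := φ) (v := EuclideanSpace.single i 1)
      ?_ ?_ ?_ (fun x _ => (hdv x).differentiableAt) (fun x _ => hφ.differentiable (by simp) x)
    · rw [this]
      congr 1
      refine integral_congr_ae (Eventually.of_forall fun x => ?_)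
      simp only
      rw [(hdv x).fderiv, smul_apply, fderiv_mollify h, smul_eq_mul]
    · have : Integrable fun x => (g' (mollify volume j v x) * mollify volume j H x i) * φ x :=
        (c2.mul hφ.continuous).integrable_of_hasCompactSupport hφc.mul_left
      refine this.congr (Eventually.of_forall fun x => ?_)
      simp only
      rw [(hdv x).fderiv, smul_apply, fderiv_mollify h, smul_eq_mul]
    · exact (c1.mul cφ).integrable_of_hasCompactSupport hφc'.mul_left
    · exact (c1.mul hφ.continuous).integrable_of_hasCompactSupport hφc.mul_left
  have hmi : ∀ j, Integrable (mollify volume j v) := integrable_mollify hv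
  have hmi' : ∀ j, Integrable (mollify volume j H) := integrable_mollify hH
  have t1 : Tendsto (fun j => ∫ x, g (mollify volume j v x)
      * fderiv ℝ φ x (EuclideanSpace.single i 1)) atTop
      (𝓝 (∫ x, g (v x) * fderiv ℝ φ x (EuclideanSpace.single i 1))) := by
    refine tendsto_integral_of_L1 _ ?_ (Eventually.of_forall fun j => ?_) ?_
    · exact (hgv.mul_bdd (c := D) cφ.aestronglyMeasurable (Eventually.of_forall hD)).1
    · have : Integrable fun x => g (mollify volume j v x) := by
        refine ((hmi j).norm.const_mul L).mono' (hgc.comp_aestronglyMeasurable (hmi j).1)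
          (Eventually.of_forall fun x => ?_)
        simpa [hg0] using hlip (mollify volume j v x) 0
      exact this.mul_bdd (c := D) cφ.aestronglyMeasurable (Eventually.of_forall hD)
    · have hb : Tendsto (fun j => ENNReal.ofReal (L * D)
          * ∫⁻ x, ‖mollify volume j v x - v x‖ₑ) atTop (𝓝 0) := by
        simpa using ENNReal.Tendsto.const_mul (tendsto_lintegral_mollify_sub hv)
          (Or.inr (ENNReal.ofReal_ne_top (r := L * D)))
      refine tendsto_of_tendsto_of_tendsto_of_le_of_le tendsto_const_nhds hb
        (fun _ => zero_le) fun j => ?_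
      simp only
      rw [← lintegral_const_mul' _ _ ENNReal.ofReal_ne_top]
      refine lintegral_mono fun x => ?_
      rw [← sub_mul, ← ofReal_norm, ← ofReal_norm, ← ENNReal.ofReal_mul (by positivity)]
      refine ENNReal.ofReal_le_ofReal ?_
      rw [norm_mul]
      calc _ ≤ (L * |mollify volume j v x - v x|) * D :=
            mul_le_mul (hlip _ _) (hD x) (norm_nonneg _) (by positivity)
        _ = _ := by rw [Real.norm_eq_abs]; ring
  have hHi : Integrable fun x => H x i := (EuclideanSpace.proj (𝕜 := ℝ) i).integrable_comp hH
  have t2 : Tendsto (fun j => ∫ x, (g' (mollify volume j v x) * mollify volume j H x i) * φ x)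
      atTop (𝓝 (∫ x, (g' (v x) * H x i) * φ x)) := by
    have hbI : ∀ {w : EuclideanSpace ℝ (Fin n) → ℝ} {K : EuclideanSpace ℝ (Fin n) → ℝ},
        AEStronglyMeasurable w → Integrable K → Integrable fun x => (g' (w x) * K x) * φ x :=
      fun hw hK => (hK.bdd_mul (c := L) (hg'.comp_aestronglyMeasurable hw)
        (Eventually.of_forall fun x => hL _)).mul_bdd (c := C) hφ.continuous.aestronglyMeasurable
          (Eventually.of_forall hC)
    refine tendsto_integral_of_L1 _ (hbI hv.1 hHi).1 (Eventually.of_forall fun j =>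
      hbI (hmi j).1 ((EuclideanSpace.proj (𝕜 := ℝ) i).integrable_comp (hmi' j))) ?_
    have hb1 : Tendsto (fun j => ENNReal.ofReal (L * C)
        * ∫⁻ x, ‖mollify volume j H x - H x‖ₑ) atTop (𝓝 0) := by
      simpa using ENNReal.Tendsto.const_mul (tendsto_lintegral_mollify_sub hH)
        (Or.inr (ENNReal.ofReal_ne_top (r := L * C)))
    -- As `g'` is merely continuous, `L¹` convergence of the mollifications does not suffice here:
    -- their a.e. convergence is used, with the dominating function `2 * L * C * ‖H x i‖`.
    have hb2 : Tendsto (fun j => ∫⁻ x, ‖(g' (mollify volume j v x) - g' (v x)) * H x i * φ x‖ₑ)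
        atTop (𝓝 0) := by
      have := tendsto_lintegral_of_dominated_convergence' (μ := volume)
        (F := fun j x => ‖(g' (mollify volume j v x) - g' (v x)) * H x i * φ x‖ₑ)
        (f := fun _ => 0) (fun x => ENNReal.ofReal (2 * L * C * ‖H x i‖)) ?_ ?_ ?_ ?_
      · simpa using this
      · intro j
        exact ((((hg'.comp_aestronglyMeasurable (hmi j).1).sub
          (hg'.comp_aestronglyMeasurable hv.1)).mul hHi.1).mul
            hφ.continuous.aestronglyMeasurable).enorm
      · refine fun j => Eventually.of_forall fun x => ?_
        simp only
        rw [← ofReal_norm]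
        refine ENNReal.ofReal_le_ofReal ?_
        rw [norm_mul, norm_mul]
        have : ‖g' (mollify volume j v x) - g' (v x)‖ ≤ 2 * L :=
          (norm_sub_le _ _).trans (by
            simp only [Real.norm_eq_abs]; linarith [hL (mollify volume j v x), hL (v x)])
        calc _ ≤ 2 * L * ‖H x i‖ * C := by gcongr; exact hC x
          _ = _ := by ring
      · exact ((hHi.norm.const_mul (2 * L * C)).lintegral_lt_top).ne
      · filter_upwards [ae_tendsto_mollify hv.locallyIntegrable] with x hx
        have h1 : Tendsto (fun j => (g' (mollify volume j v x) - g' (v x)) * H x i * φ x) atTop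
            (𝓝 ((g' (v x) - g' (v x)) * H x i * φ x)) :=
          ((((hg'.tendsto _).comp hx).sub_const _).mul_const _).mul_const _
        simpa using h1.enorm
    have hb := hb1.add hb2
    rw [add_zero] at hb
    refine tendsto_of_tendsto_of_tendsto_of_le_of_le tendsto_const_nhds hb
      (fun _ => zero_le) fun j => ?_
    simp only
    rw [← lintegral_const_mul' _ _ ENNReal.ofReal_ne_top, ← lintegral_add_left']
    · refine lintegral_mono fun x => ?_
      have e : g' (mollify volume j v x) * mollify volume j H x i * φ x - g' (v x) * H x i * φ x
          = g' (mollify volume j v x) * φ x * (mollify volume j H x - H x) i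
            + (g' (mollify volume j v x) - g' (v x)) * H x i * φ x := by
        simp only [PiLp.sub_apply]; ring
      rw [e]
      refine (enorm_add_le _ _).trans ?_
      gcongr
      rw [← ofReal_norm, ← ofReal_norm, ← ENNReal.ofReal_mul (by positivity)]
      refine ENNReal.ofReal_le_ofReal ?_
      rw [norm_mul, norm_mul]
      gcongr
      · exact hL _
      · exact hC x
      · exact PiLp.norm_apply_le _ i
    · exact (((hmi' j).1.sub hH.1).enorm.const_mul _)
  have := tendsto_nhds_unique t1 (by simpa only [hparts] using t2.neg)
  rw [this]
  rfl

end

/-! ### Localized chain rule and Sobolev inequalities. -/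

section

open Filter Topology Metric Set
open scoped Manifold NNReal

variable {n : ℕ} {Ω : Set (EuclideanSpace ℝ (Fin n))} {u : EuclideanSpace ℝ (Fin n) → ℝ}
  {G : EuclideanSpace ℝ (Fin n) → EuclideanSpace ℝ (Fin n)}

/-- A test function that equals one near a compact subset of an open set. -/
theorem exists_testFunction_one_nhds {K : Set (EuclideanSpace ℝ (Fin n))} (hK : IsCompact K)
    (hΩ : IsOpen Ω) (hKΩ : K ⊆ Ω) : ∃ χ : EuclideanSpace ℝ (Fin n) → ℝ, ContDiff ℝ ∞ χ ∧
      HasCompactSupport χ ∧ tsupport χ ⊆ Ω ∧ ∀ᶠ x in 𝓝ˢ K, χ x = 1 := by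
  obtain ⟨K', hK', hKK', hKΩ'⟩ := exists_compact_between hK hΩ hKΩ
  obtain ⟨χ, h1, h0, -⟩ := exists_contMDiffMap_one_nhds_of_subset_interior
    (I := 𝓘(ℝ, EuclideanSpace ℝ (Fin n))) (n := ⊤) hK.isClosed hKK'
  refine ⟨χ, χ.contMDiff.contDiff, HasCompactSupport.intro hK' h0, ?_, h1⟩
  refine (closure_minimal (fun x hx => ?_) hK'.isClosed).trans hKΩ'
  by_contra hxK
  exact hx (h0 x hxK)

/-- The chain rule, followed by multiplication with a test function. -/
theorem HasWeakGradient.testFunction_mul_comp (h : HasWeakGradient Ω u G) (hΩ : IsOpen Ω)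
    {ζ : EuclideanSpace ℝ (Fin n) → ℝ} (hζ : ContDiff ℝ ∞ ζ) (hc : HasCompactSupport ζ)
    (hs : tsupport ζ ⊆ Ω) {g g' : ℝ → ℝ} (hg : ∀ t, HasDerivAt g (g' t) t)
    (hg' : Continuous g') {L : ℝ} (hL : ∀ t, |g' t| ≤ L) (hg0 : g 0 = 0) :
    Integrable (fun x => ζ x * g (u x)) ∧
    HasWeakGradient univ (fun x => ζ x * g (u x))
      (fun x => ζ x • g' (u x) • G x + g (u x) • gradient ζ x) := by
  -- The global chain rule is applied to `χ * u`, which is integrable on the whole space. Near the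
  -- support of `ζ` one has `χ = 1` and `∇χ = 0`, so `χ` disappears after multiplication by `ζ`.
  obtain ⟨χ, hχ, hχc, hχK, h1⟩ := exists_testFunction_one_nhds hc hΩ hs
  obtain ⟨i1, i2, w1⟩ := h.smul_testFunction hχ hχc hχK
  obtain ⟨i3, i4, w3⟩ := (w1.comp i1 i2 hg hg' hL hg0).smul_testFunction hζ hc (subset_univ _)
  have e1 : (fun x => ζ x * g (χ x * u x)) = fun x => ζ x * g (u x) := by
    ext x
    by_cases hx : x ∈ tsupport ζ
    · rw [(h1.self_of_nhdsSet x hx : χ x = 1), one_mul]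
    · rw [image_eq_zero_of_notMem_tsupport hx, zero_mul, zero_mul]
  have e2 : (fun x => ζ x • g' (χ x * u x) • (χ x • G x + u x • gradient χ x)
      + g (χ x * u x) • gradient ζ x)
      = fun x => ζ x • g' (u x) • G x + g (u x) • gradient ζ x := by
    ext1 x
    by_cases hx : x ∈ tsupport ζ
    · have hev : χ =ᶠ[𝓝 x] fun _ => 1 :=
        h1.filter_mono (nhds_le_nhdsSet hx)
      have : gradient χ x = 0 := by
        rw [gradient, hev.fderiv_eq]; simp
      rw [(h1.self_of_nhdsSet x hx : χ x = 1), this]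
      simp
    · rw [image_eq_zero_of_notMem_tsupport hx, gradient_eq_zero_of_notMem_tsupport hx]
      simp
  rw [e1] at i3 w3
  rw [e2] at w3
  exact ⟨i3, w3⟩

/-- The Sobolev inequality for weakly differentiable functions with compact support. -/
theorem HasWeakGradient.eLpNorm_le (hn : 0 < n) {p p' : ℝ≥0} (hp : 1 ≤ p)
    (hp' : (p' : ℝ)⁻¹ = (p : ℝ)⁻¹ - (n : ℝ)⁻¹)
    {v : EuclideanSpace ℝ (Fin n) → ℝ} {H : EuclideanSpace ℝ (Fin n) → EuclideanSpace ℝ (Fin n)}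
    (hv : HasWeakGradient univ v H) (hc : HasCompactSupport v) :
    eLpNorm v p' volume ≤ SNormLESNormFDerivOfEqConst ℝ
      (volume : Measure (EuclideanSpace ℝ (Fin n))) p * eLpNorm H p volume := by
  have hvl : LocallyIntegrable v := locallyIntegrableOn_univ.1 hv.1
  have hHl : LocallyIntegrable H := locallyIntegrableOn_univ.1 hv.2
  -- The smooth Sobolev inequality holds for the mollifications, with a right side that is uniform
  -- in `j` because mollification contracts `L^p`; Fatou's lemma then gives the claim.
  have hj : ∀ j, eLpNorm (mollify volume j v) p' volume ≤ SNormLESNormFDerivOfEqConst ℝ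
      (volume : Measure (EuclideanSpace ℝ (Fin n))) p * eLpNorm H p volume := by
    intro j
    refine (eLpNorm_le_eLpNorm_fderiv_of_eq volume ((contDiff_mollify hvl j).of_le (by simp))
      (hasCompactSupport_mollify hc j) hp (by simpa using hn) (by simpa using hp')).trans ?_
    gcongr
    have hp0 : (p : ℝ≥0∞) ≠ 0 := by
      simpa using (zero_lt_one.trans_le hp).ne'
    rw [eLpNorm_eq_lintegral_rpow_enorm_toReal hp0 ENNReal.coe_ne_top,
      eLpNorm_eq_lintegral_rpow_enorm_toReal hp0 ENNReal.coe_ne_top, ENNReal.coe_toReal]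
    refine ENNReal.rpow_le_rpow ?_ (by positivity)
    refine le_trans (le_of_eq ?_) (lintegral_mollify_rpow_le hHl.aestronglyMeasurable
      (by exact_mod_cast hp) j)
    refine lintegral_congr fun x => ?_
    rw [← ofReal_norm, norm_fderiv_mollify hv, ofReal_norm]
  refine (Lp.eLpNorm_lim_le_liminf_eLpNorm
    (fun j => (contDiff_mollify hvl j).continuous.aestronglyMeasurable) v
    (ae_tendsto_mollify hvl)).trans ?_
  exact liminf_le_of_frequently_le' (Frequently.of_forall hj)

/-- The Sobolev inequality in balls of radius one, for exponents below a Sobolev conjugate. -/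
theorem exists_sobolev_const (hn : 0 < n) {p pt p' : ℝ} (hpt : 1 ≤ pt) (hptp : pt ≤ p)
    (hp'0 : 0 < p') (hp' : p'⁻¹ = pt⁻¹ - (n : ℝ)⁻¹) : ∃ C : ℝ≥0, ∀ (x₀ : EuclideanSpace ℝ (Fin n))
    (v : EuclideanSpace ℝ (Fin n) → ℝ) (H : EuclideanSpace ℝ (Fin n) → EuclideanSpace ℝ (Fin n)),
    HasWeakGradient univ v H → (∀ x ∉ closedBall x₀ 1, v x = 0) →
    (∀ x ∉ closedBall x₀ 1, H x = 0) →
    eLpNorm v (ENNReal.ofReal p') volume ≤ C * eLpNorm H (ENNReal.ofReal p) volume := by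
  set m := volume (closedBall (0 : EuclideanSpace ℝ (Fin n)) 1) with hm
  have hm' : m ≠ ⊤ := (isCompact_closedBall _ _).measure_lt_top.ne
  have hd : 0 ≤ 1 / pt - 1 / p := sub_nonneg.2 (one_div_le_one_div_of_le (by linarith) hptp)
  refine ⟨SNormLESNormFDerivOfEqConst ℝ (volume : Measure (EuclideanSpace ℝ (Fin n)))
    pt.toNNReal * (m ^ (1 / pt - 1 / p)).toNNReal, fun x₀ v H h hv hH => ?_⟩
  have h1 := h.eLpNorm_le hn (p := pt.toNNReal) (p' := p'.toNNReal)
    (by rwa [← Real.toNNReal_one, Real.toNNReal_le_toNNReal_iff (by linarith)])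
    (by rwa [Real.coe_toNNReal _ hp'0.le, Real.coe_toNNReal _ (by linarith)])
    (HasCompactSupport.intro (isCompact_closedBall x₀ 1) hv)
  refine h1.trans ?_
  have hs : Function.support H ⊆ closedBall x₀ 1 := fun x hx => by
    by_contra h'; exact hx (hH x h')
  -- Hölder on the unit ball raises the exponent of the gradient from `pt` to `p`, at the price of a
  -- power of the volume.
  have h2 := eLpNorm_le_eLpNorm_mul_rpow_measure_univ
    (μ := volume.restrict (closedBall x₀ 1)) (f := H) (ENNReal.ofReal_le_ofReal hptp)
    (locallyIntegrableOn_univ.1 h.2).aestronglyMeasurable.restrict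
  rw [eLpNorm_restrict_eq_of_support_subset hs, eLpNorm_restrict_eq_of_support_subset hs,
    Measure.restrict_apply_univ, Measure.addHaar_closedBall_center,
    ENNReal.toReal_ofReal (by linarith), ENNReal.toReal_ofReal (by linarith), ← hm] at h2
  rw [ENNReal.coe_mul, ENNReal.coe_toNNReal (ENNReal.rpow_ne_top_of_nonneg hd hm'), mul_assoc,
    mul_comm (m ^ _)]
  gcongr
  exact h2

/-- Sobolev functions are locally integrable to any power up to the Sobolev conjugate. -/
theorem MemW1Loc.memLp_of_isCompact (hn : 0 < n) {q pt p' : ℝ} (h : MemW1Loc Ω q u G)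
    (hΩ : IsOpen Ω) (hpt : 1 ≤ pt) (hptq : pt ≤ q) (hp'0 : 0 < p')
    (hp' : p'⁻¹ = pt⁻¹ - (n : ℝ)⁻¹) {K : Set (EuclideanSpace ℝ (Fin n))} (hK : IsCompact K)
    (hKΩ : K ⊆ Ω) : MemLp u (ENNReal.ofReal p') (volume.restrict K) := by
  obtain ⟨hw, hu, hG⟩ := h
  obtain ⟨χ, hχ, hχc, hχΩ, h1⟩ := exists_testFunction_one_nhds hK hΩ hKΩ
  obtain ⟨i1, i2, w1⟩ := hw.smul_testFunction hχ hχc hχΩ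
  have hsob := w1.eLpNorm_le hn (p := pt.toNNReal) (p' := p'.toNNReal)
    (by rwa [← Real.toNNReal_one, Real.toNNReal_le_toNNReal_iff (by linarith)])
    (by rwa [Real.coe_toNNReal _ hp'0.le, Real.coe_toNNReal _ (by linarith)]) hχc.mul_right
  obtain ⟨C, hC⟩ := hχ.continuous.bounded_above_of_compact_support hχc
  obtain ⟨D, hD⟩ := (continuous_gradient hχ).bounded_above_of_compact_support
    (hasCompactSupport_gradient hχc)
  have hfin : volume (tsupport χ) ≠ ⊤ := hχc.isCompact.measure_lt_top.ne
  have : IsFiniteMeasure (volume.restrict (tsupport χ)) :=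
    isFiniteMeasure_restrict.2 hfin
  have hH : MemLp (fun x => χ x • G x + u x • gradient χ x) (ENNReal.ofReal q)
      (volume.restrict (tsupport χ)) := by
    refine (((hG _ hχc hχΩ).norm.const_mul C).add ((hu _ hχc hχΩ).norm.const_mul D)).mono
      i2.1.restrict (Eventually.of_forall fun x => ?_)
    refine (norm_add_le _ _).trans (le_trans ?_ (le_abs_self _))
    rw [norm_smul, norm_smul, Pi.add_apply, mul_comm ‖u x‖]
    gcongr
    · exact hC x
    · exact hD x
  have hH' := (hH.mono_exponent (ENNReal.ofReal_le_ofReal hptq)).2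
  rw [eLpNorm_restrict_eq_of_support_subset] at hH'
  · have hv : MemLp (fun x => χ x * u x) (ENNReal.ofReal p') volume :=
      ⟨i1.1, hsob.trans_lt (ENNReal.mul_lt_top ENNReal.coe_lt_top hH')⟩
    refine (hv.restrict K).ae_eq ?_
    filter_upwards [ae_restrict_mem hK.measurableSet] with x hx
    rw [(h1.self_of_nhdsSet x hx : χ x = 1), one_mul]
  · intro x hx
    by_contra h'
    simp [image_eq_zero_of_notMem_tsupport h', gradient_eq_zero_of_notMem_tsupport h'] at hx

end

/-! ### Relations between the exponents and absorption of lower order terms. -/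

section

open Filter Topology Metric Set
open scoped NNReal

/-- The inequalities between the exponents on which the iteration rests. -/
structure IterationExponents (p q θ δ s₀ s₁ pstar lam : ℝ) : Prop where
  one_le_p : 1 ≤ p
  p_le_q : p ≤ q
  q_lt : q < p + 1
  θ_nonneg : 0 ≤ θ
  one_le_δ : 1 ≤ δ
  one_lt_s₀ : 1 < s₀
  one_lt_s₁ : 1 < s₁
  le_lam : p / (p - q + 1) ≤ lam
  θ_le : θ ≤ lam
  δ_le : δ ≤ lam
  s₀_le : pstar / s₀ + 1 ≤ lam
  s₁_le : pstar / s₁ + 1 ≤ lam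
  lam_lt : lam < pstar
  lt_s₀ : p < pstar * (1 - 1 / s₀)
  lt_s₁ : p < pstar * (1 - 1 / s₁)

namespace AdmissibleExponents

variable {n : ℕ} {p q θ δ s₀ s₁ pstar : ℝ}

/-- For `p < n`, clearing denominators turns this into the gap condition `q / p < 1 + 1 / n`. -/
theorem div_lt_pstar (h : AdmissibleExponents n p q θ δ s₀ s₁ pstar) :
    p / (p - q + 1) < pstar := by
  rcases lt_or_ge p n with hp | hp
  · obtain ⟨h1, h2, -, -⟩ := h.of_lt hp
    have hn : (0 : ℝ) < n := by linarith [h.one_le_p]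
    have h3 : 0 < p - q + 1 := by linarith [h.q_lt]
    have hp0 : 0 < p := by linarith [h.one_le_p]
    rw [h2, div_lt_div_iff₀ h3 (by linarith)]
    have h4 : q < p + p / n := by
      have := (div_lt_iff₀ hp0).1 h1
      calc q < (1 + 1 / n) * p := this
        _ = p + p / n := by ring
    have h5 : q * n < p * n + p := by
      have := mul_lt_mul_of_pos_right h4 hn
      rwa [add_mul, div_mul_cancel₀ _ hn.ne'] at this
    nlinarith
  · exact (h.of_ge hp).2.2.1

theorem p_lt_pstar (h : AdmissibleExponents n p q θ δ s₀ s₁ pstar) : p < pstar := by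
  refine lt_of_le_of_lt ?_ h.div_lt_pstar
  have h3 : 0 < p - q + 1 := by linarith [h.q_lt]
  rw [le_div_iff₀ h3]
  nlinarith [h.one_le_p, h.p_le_q]

/-- For `p < n` one has `p / pstar = 1 - p / n`, so the claim amounts to `n / p < s`; for `p ≥ n` it
rearranges the assumed bound on `pstar`. The inequality `p / pstar < 1 - 1 / s` is what makes the
recursion superlinear. -/
theorem one_lt_and_lt (h : AdmissibleExponents n p q θ δ s₀ s₁ pstar) {s : ℝ}
    (hs : n / p < s) (hs' : n ≤ p → 1 < s ∧ p * s / (s - 1) < pstar) :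
    1 < s ∧ p < pstar * (1 - 1 / s) := by
  have hp0 : 0 < p := by linarith [h.one_le_p]
  rcases lt_or_ge p n with hp | hp
  · obtain ⟨-, h2, -, -⟩ := h.of_lt hp
    have h1 : 1 < s := lt_trans (by rwa [one_lt_div hp0]) hs
    refine ⟨h1, ?_⟩
    have hn : (0 : ℝ) < n := hp0.trans hp
    have hnp : 0 < n - p := by linarith
    have h3 : 1 / s < p / n := by
      rw [one_div, inv_lt_comm₀ (by linarith) (by positivity), inv_div]
      exact hs
    have h4 : 0 < pstar := hp0.trans h.p_lt_pstar
    calc p = pstar * (1 - p / n) := by rw [h2]; field_simp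
      _ < _ := by gcongr
  · obtain ⟨h1, h2⟩ := hs' hp
    refine ⟨h1, ?_⟩
    rw [div_lt_iff₀ (by linarith)] at h2
    have : pstar * (1 - 1 / s) = pstar * (s - 1) / s := by field_simp
    rw [this, lt_div_iff₀ (by linarith)]
    exact h2

/-- `p*` is the Sobolev conjugate of some exponent that is at most `p`. -/
theorem exists_sobolev_exponent (h : AdmissibleExponents n p q θ δ s₀ s₁ pstar) (hn : 2 ≤ n) :
    ∃ pt : ℝ, 1 ≤ pt ∧ pt ≤ p ∧ pstar⁻¹ = pt⁻¹ - (n : ℝ)⁻¹ := by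
  have hp0 : 0 < p := by linarith [h.one_le_p]
  have hn' : (2 : ℝ) ≤ n := by exact_mod_cast hn
  have hP := h.p_lt_pstar
  rcases lt_or_ge p n with hp | hp
  · refine ⟨p, h.one_le_p, le_rfl, ?_⟩
    rw [(h.of_lt hp).2.1]
    have : (n : ℝ) - p ≠ 0 := by linarith
    field_simp
  · have hP0 : 0 < pstar := hp0.trans hP
    have hnP : 0 < n + pstar := by linarith
    -- The witness solves `1 / pt = 1 / pstar + 1 / n`. It is at most `p` because `n ≤ p`, and at
    -- least `1` because `n` and `pstar` are at least `2`.
    refine ⟨n * pstar / (n + pstar), ?_, ?_, ?_⟩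
    · rw [le_div_iff₀ hnP]; nlinarith
    · rw [div_le_iff₀ hnP]; nlinarith
    · have : (n : ℝ) ≠ 0 := by linarith
      field_simp
      ring

/-- `pstar - σ` is the maximum in the definition of `σ`, so it bounds each entry; that it lies below
`pstar` is the positivity of `σ`. -/
theorem iterationExponents (h : AdmissibleExponents n p q θ δ s₀ s₁ pstar) :
    IterationExponents p q θ δ s₀ s₁ pstar (pstar - sigmaExponent p q θ δ s₀ s₁ pstar) := by
  have h0 := h.one_lt_and_lt h.lt_s₀ fun hp => ⟨(h.of_ge hp).1, (h.of_ge hp).2.2.2.2.2.2⟩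
  have h1 := h.one_lt_and_lt h.lt_s₁ fun hp => ⟨(h.of_ge hp).2.1, (h.of_ge hp).2.2.2.2.2.1⟩
  have hθδ : θ < pstar ∧ δ < pstar := by
    rcases lt_or_ge p n with hp | hp
    · exact ⟨(h.of_lt hp).2.2.1, (h.of_lt hp).2.2.2⟩
    · exact ⟨(h.of_ge hp).2.2.2.1, (h.of_ge hp).2.2.2.2.1⟩
  have hlt : ∀ {s : ℝ}, p < pstar * (1 - 1 / s) → pstar / s + 1 < pstar := by
    intro s hs
    have : pstar * (1 - 1 / s) = pstar - pstar / s := by ring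
    linarith [h.one_le_p]
  simp only [sigmaExponent, sub_sub_cancel]
  refine ⟨h.one_le_p, h.p_le_q, h.q_lt, h.θ_nonneg, h.one_le_δ, h0.1, h1.1, ?_, ?_, ?_, ?_, ?_,
    ?_, h0.2, h1.2⟩
  · simp
  · simp
  · simp
  · simp
  · simp
  · simp only [max_lt_iff]
    exact ⟨h.div_lt_pstar, hlt h1.2, hlt h0.2, hθδ⟩

end AdmissibleExponents

namespace IterationExponents

variable {p q θ δ s₀ s₁ pstar lam : ℝ}

/-- Equivalent to `0 ≤ (q - 1) * (q - p)`. -/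
theorem q_le_div (h : IterationExponents p q θ δ s₀ s₁ pstar lam) : q ≤ p / (p - q + 1) := by
  rw [le_div_iff₀ (by linarith [h.q_lt])]
  nlinarith [h.one_le_p, h.p_le_q]

end IterationExponents

/-- Young's inequality with exponents `p / (q - 1)` and `p / (p - q + 1)`. Comparing `c * Y` with `ε
* X ^ (p - q + 1)` directly, one of the two terms on the right suffices in each case, and `q = 1`
needs no separate treatment. -/
theorem exists_young_const {p q : ℝ} (hq1 : 1 ≤ q) (hqp : q < p + 1) {c ε : ℝ}
    (hc : 0 ≤ c) (hε : 0 < ε) : ∃ C, 0 ≤ C ∧ ∀ X Y : ℝ, 0 ≤ X → 0 ≤ Y →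
      c * Y * X ^ (q - 1) ≤ ε * X ^ p + C * Y ^ (p / (p - q + 1)) := by
  have hd : 0 < p - q + 1 := by linarith
  refine ⟨c * (c / ε) ^ ((q - 1) / (p - q + 1)), by positivity, fun X Y hX hY => ?_⟩
  have hXp : X ^ p = X ^ (p - q + 1) * X ^ (q - 1) := by
    rw [← Real.rpow_add_of_nonneg hX hd.le (by linarith)]; congr 1; ring
  rcases le_or_gt (c * Y) (ε * X ^ (p - q + 1)) with h | h
  · have : 0 ≤ c * (c / ε) ^ ((q - 1) / (p - q + 1)) * Y ^ (p / (p - q + 1)) := by positivity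
    rw [hXp]
    nlinarith [mul_le_mul_of_nonneg_right h (Real.rpow_nonneg hX (q - 1))]
  · have h1 : X ^ (p - q + 1) ≤ c / ε * Y := by
      rw [div_mul_eq_mul_div, le_div_iff₀ hε]; linarith
    have h2 : X ^ (q - 1) ≤ (c / ε * Y) ^ ((q - 1) / (p - q + 1)) := by
      calc X ^ (q - 1) = (X ^ (p - q + 1)) ^ ((q - 1) / (p - q + 1)) := by
            rw [← Real.rpow_mul hX]; congr 1; field_simp
        _ ≤ _ := Real.rpow_le_rpow (by positivity) h1 (div_nonneg (by linarith) hd.le)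
    have h3 : Y ^ (p / (p - q + 1)) = Y * Y ^ ((q - 1) / (p - q + 1)) := by
      have : p / (p - q + 1) = 1 + (q - 1) / (p - q + 1) := by field_simp; ring
      rw [this, Real.rpow_add_of_nonneg hY zero_le_one (div_nonneg (by linarith) hd.le),
        Real.rpow_one]
    rw [Real.mul_rpow (by positivity) hY] at h2
    have h4 : 0 ≤ ε * X ^ p := by positivity
    rw [h3]
    nlinarith [mul_le_mul_of_nonneg_left h2 (mul_nonneg hc hY)]

/-- As `p ≤ q`, the gradient growth `(p + q - 2) / 2` of `b` is at most the growth `q - 1` of `a`,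
so the same Young inequality handles both. -/
theorem one_add_sq_rpow_le {p q X : ℝ} (hp : 1 ≤ p) (hpq : p ≤ q) (hX : 0 ≤ X) :
    (1 + X ^ 2) ^ ((p + q - 2) / 4) ≤ 2 ^ (q - 1) * (1 + X ^ (q - 1)) := by
  have h1 : (1 + X ^ 2) ^ ((p + q - 2) / 4) ≤ (1 + X) ^ (q - 1) := by
    calc (1 + X ^ 2) ^ ((p + q - 2) / 4) ≤ ((1 + X) ^ (2 : ℝ)) ^ ((p + q - 2) / 4) := by
          refine Real.rpow_le_rpow (by positivity) ?_ (by linarith)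
          rw [Real.rpow_two]; nlinarith
      _ = (1 + X) ^ ((p + q - 2) / 2) := by
          rw [← Real.rpow_mul (by positivity)]; congr 1; ring
      _ ≤ _ := Real.rpow_le_rpow_of_exponent_le (by linarith) (by linarith)
  refine h1.trans ?_
  have h2 : 0 ≤ q - 1 := by linarith
  rcases le_total X 1 with h | h
  · calc (1 + X) ^ (q - 1) ≤ 2 ^ (q - 1) := Real.rpow_le_rpow (by positivity) (by linarith) h2
      _ ≤ 2 ^ (q - 1) * (1 + X ^ (q - 1)) := by
          have : 0 ≤ X ^ (q - 1) := by positivity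
          have h5 : (0 : ℝ) ≤ 2 ^ (q - 1) := by positivity
          nlinarith
  · calc (1 + X) ^ (q - 1) ≤ (2 * X) ^ (q - 1) :=
          Real.rpow_le_rpow (by positivity) (by linarith) h2
      _ = 2 ^ (q - 1) * X ^ (q - 1) := Real.mul_rpow (by norm_num) hX
      _ ≤ 2 ^ (q - 1) * (1 + X ^ (q - 1)) := by gcongr; linarith

/-- The lower order terms are absorbed by the coercive term. -/
theorem exists_absorption_const {p q θ δ s₀ s₁ pstar lam : ℝ}
    (h : IterationExponents p q θ δ s₀ s₁ pstar lam) {c₁ c₂ c₃ c₄ M : ℝ} (hc₁ : 0 < c₁)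
    (hc₂ : 0 < c₂) (hc₃ : 0 < c₃) (hc₄ : 0 < c₄) (hM : 0 < M) {N : ℕ} (hN : p / (p - q + 1) ≤ N) :
    ∃ C, 0 ≤ C ∧ ∀ η X U L b₀ b₁ : ℝ, 0 ≤ η → η ≤ 1 → 0 ≤ X → 1 ≤ U → 1 ≤ L → 0 ≤ b₀ → 0 ≤ b₁ →
      η ^ N * (c₂ * U ^ θ + b₁)
        + U * (N * η ^ (N - 1) * L)
          * (c₃ * X ^ (q - 1) + c₄ * U ^ ((q - 1) * (2 / (q - p + 2))) + b₁)
        + U * η ^ N * (M * (1 + X ^ 2) ^ ((p + q - 2) / 4) + M * U ^ (δ - 1) + b₀)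
      ≤ c₁ / 2 * (η ^ N * X ^ p)
        + C * L ^ (p / (p - q + 1)) * (U ^ lam + U * (b₀ + b₁)) := by
  have hp := h.one_le_p
  have hpq := h.p_le_q
  have hq1 : 1 ≤ q := hp.trans hpq
  have hd : 0 < p - q + 1 := by linarith [h.q_lt]
  set τ := p / (p - q + 1) with hτ
  have hqτ : q ≤ τ := h.q_le_div
  have hτ1 : 1 ≤ τ := hq1.trans hqτ
  have hN1 : 1 ≤ N := by
    have : (1 : ℝ) ≤ N := hτ1.trans hN
    exact_mod_cast this
  -- Young's inequality is used for one term of `a` and one of `b`; with `c₁ / 4` each, half of the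
  -- coercivity remains.
  obtain ⟨C₁, hC₁, hY₁⟩ := exists_young_const (p := p) hq1 h.q_lt (c := N * c₃) (ε := c₁ / 4)
    (by positivity) (by positivity)
  obtain ⟨C₂, hC₂, hY₂⟩ := exists_young_const (p := p) hq1 h.q_lt (c := M * 2 ^ (q - 1))
    (ε := c₁ / 4) (by positivity) (by positivity)
  refine ⟨c₂ + 1 + C₁ + N * c₄ + N + M * 2 ^ (q - 1) + C₂ + M, by positivity, ?_⟩
  intro η X U L b₀ b₁ hη hη1 hX hU hL hb₀ hb₁
  have hU0 : 0 < U := by linarith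
  have hL0 : 0 < L := by linarith
  set T := L ^ τ with hT
  set V := U ^ lam with hV
  have hT1 : 1 ≤ T := Real.one_le_rpow hL (by linarith)
  have hLT : L ≤ T := by
    calc L = L ^ (1 : ℝ) := (Real.rpow_one L).symm
      _ ≤ T := Real.rpow_le_rpow_of_exponent_le hL hτ1
  have hUle : ∀ {e : ℝ}, e ≤ lam → U ^ e ≤ V := fun he => Real.rpow_le_rpow_of_exponent_le hU he
  have hV0 : 0 ≤ V := by positivity
  have hζ1 : η ^ N ≤ 1 := pow_le_one₀ hη hη1
  have hζ0 : 0 ≤ η ^ N := by positivity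
  have hζ' : η ^ (N - 1) ≤ 1 := pow_le_one₀ hη hη1
  have hζ'0 : 0 ≤ η ^ (N - 1) := by positivity
  set Xt := η ^ ((N : ℝ) / p) * X with hXt
  have hXt0 : 0 ≤ Xt := by positivity
  have hp0 : 0 < p := by linarith
  have hXtp : Xt ^ p = η ^ N * X ^ p := by
    rw [hXt, Real.mul_rpow (by positivity) hX, ← Real.rpow_mul hη, div_mul_cancel₀ _ hp0.ne',
      Real.rpow_natCast]
  -- Differentiating `η ^ N` costs one power of `η`. What is needed is `N * (q - 1) / p ≤ N - 1`,
  -- which is equivalent to `p / (p - q + 1) ≤ N`.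
  have hXtq : η ^ (N - 1) * X ^ (q - 1) ≤ Xt ^ (q - 1) := by
    rw [hXt, Real.mul_rpow (by positivity) hX, ← Real.rpow_mul hη]
    gcongr
    rw [← Real.rpow_natCast, Nat.cast_sub hN1, Nat.cast_one]
    refine Real.rpow_le_rpow_of_exponent_ge' hη hη1 (mul_nonneg (by positivity) (by linarith)) ?_
    rw [div_mul_eq_mul_div, div_le_iff₀ hp0]
    rw [hτ, div_le_iff₀ hd] at hN
    nlinarith
  have hUτ : U ^ τ ≤ V := hUle h.le_lam
  have hTV : V ≤ T * V := le_mul_of_one_le_left hV0 hT1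
  have b1 : η ^ N * (c₂ * U ^ θ + b₁) ≤ c₂ * (T * V) + T * (U * b₁) := by
    have e1 : c₂ * U ^ θ + b₁ ≤ c₂ * (T * V) + T * (U * b₁) := by
      have : U ^ θ ≤ T * V := (hUle h.θ_le).trans hTV
      have h2 : b₁ ≤ T * (U * b₁) := by
        have := le_mul_of_one_le_left hb₁ hU
        exact this.trans (le_mul_of_one_le_left (by positivity) hT1)
      nlinarith
    exact (mul_le_of_le_one_left (by positivity) hζ1).trans e1
  -- The slope `L` of the cutoff enters Young's inequality together with `U`; this is the origin of
  -- the power `L ^ τ`, and of the requirement `τ ≤ lam`.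
  have b2 : N * c₃ * (L * U) * Xt ^ (q - 1) ≤ c₁ / 4 * Xt ^ p + C₁ * (T * V) := by
    refine (hY₁ Xt (L * U) hXt0 (by positivity)).trans ?_
    rw [Real.mul_rpow hL0.le hU0.le]
    gcongr
  have b2' : U * (N * η ^ (N - 1) * L) * (c₃ * X ^ (q - 1))
      ≤ c₁ / 4 * (η ^ N * X ^ p) + C₁ * (T * V) := by
    rw [← hXtp]
    refine le_trans ?_ b2
    calc U * (N * η ^ (N - 1) * L) * (c₃ * X ^ (q - 1))
        = N * c₃ * (L * U) * (η ^ (N - 1) * X ^ (q - 1)) := by ring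
      _ ≤ _ := by gcongr
  have b3 : U * (N * η ^ (N - 1) * L) * (c₄ * U ^ ((q - 1) * (2 / (q - p + 2))))
      ≤ N * c₄ * (T * V) := by
    have e1 : U ^ ((q - 1) * (2 / (q - p + 2))) ≤ U ^ (q - 1) := by
      refine Real.rpow_le_rpow_of_exponent_le hU ?_
      refine mul_le_of_le_one_right (by linarith) ?_
      rw [div_le_one (by linarith)]
      linarith
    have e2 : U * U ^ (q - 1) = U ^ q := by
      rw [← Real.rpow_one_add' hU0.le (by linarith)]; congr 1; ring
    calc U * (N * η ^ (N - 1) * L) * (c₄ * U ^ ((q - 1) * (2 / (q - p + 2))))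
        ≤ U * (N * 1 * T) * (c₄ * U ^ (q - 1)) := by gcongr
      _ = N * c₄ * (T * U ^ q) := by rw [← e2]; ring
      _ ≤ _ := by
        gcongr
        exact hUle (hqτ.trans h.le_lam)
  have b4 : U * (N * η ^ (N - 1) * L) * b₁ ≤ N * (T * (U * b₁)) := by
    calc U * (N * η ^ (N - 1) * L) * b₁ ≤ U * (N * 1 * T) * b₁ := by gcongr
      _ = _ := by ring
  have b5 : U * η ^ N * (M * (1 + X ^ 2) ^ ((p + q - 2) / 4))
      ≤ M * 2 ^ (q - 1) * (T * V) + (c₁ / 4 * (η ^ N * X ^ p) + C₂ * (T * V)) := by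
    have e1 : M * 2 ^ (q - 1) * U * Xt ^ (q - 1) ≤ c₁ / 4 * (η ^ N * X ^ p) + C₂ * (T * V) := by
      rw [← hXtp]
      refine (hY₂ Xt U hXt0 hU0.le).trans ?_
      gcongr
      exact hUτ.trans hTV
    have e2 : η ^ N ≤ η ^ (N - 1) := pow_le_pow_of_le_one hη hη1 (Nat.sub_le _ _)
    have e3 : U ≤ T * V := by
      refine le_trans ?_ hTV
      calc U = U ^ (1 : ℝ) := (Real.rpow_one U).symm
        _ ≤ V := hUle (hτ1.trans h.le_lam)
    calc U * η ^ N * (M * (1 + X ^ 2) ^ ((p + q - 2) / 4))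
        ≤ U * η ^ N * (M * (2 ^ (q - 1) * (1 + X ^ (q - 1)))) := by
          gcongr; exact one_add_sq_rpow_le hp hpq hX
      _ = M * 2 ^ (q - 1) * (U * η ^ N) + M * 2 ^ (q - 1) * U * (η ^ N * X ^ (q - 1)) := by ring
      _ ≤ M * 2 ^ (q - 1) * (U * 1) + M * 2 ^ (q - 1) * U * (η ^ (N - 1) * X ^ (q - 1)) := by
          gcongr
      _ ≤ M * 2 ^ (q - 1) * (T * V) + M * 2 ^ (q - 1) * U * Xt ^ (q - 1) := by
          rw [mul_one]; gcongr
      _ ≤ _ := by linarith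
  have b6 : U * η ^ N * (M * U ^ (δ - 1)) ≤ M * (T * V) := by
    have e2 : U * U ^ (δ - 1) = U ^ δ := by
      rw [← Real.rpow_one_add' hU0.le (by linarith [h.one_le_δ])]; congr 1; ring
    calc U * η ^ N * (M * U ^ (δ - 1)) ≤ U * 1 * (M * U ^ (δ - 1)) := by gcongr
      _ = M * U ^ δ := by rw [← e2]; ring
      _ ≤ M * (T * V) := by gcongr; exact (hUle h.δ_le).trans hTV
  have b7 : U * η ^ N * b₀ ≤ T * (U * b₀) := by
    calc U * η ^ N * b₀ ≤ U * 1 * b₀ := by gcongr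
      _ = U * b₀ := by ring
      _ ≤ _ := le_mul_of_one_le_left (by positivity) hT1
  have pTV : 0 ≤ T * V := by positivity
  have p0 : 0 ≤ T * (U * b₀) := by positivity
  have p1 : 0 ≤ T * (U * b₁) := by positivity
  have k0 : T * (U * b₀) ≤ (c₂ + 1 + C₁ + N * c₄ + N + M * 2 ^ (q - 1) + C₂ + M)
      * (T * (U * b₀)) := by
    refine le_mul_of_one_le_left p0 ?_
    have : 0 ≤ c₂ + C₁ + N * c₄ + N + M * 2 ^ (q - 1) + C₂ + M := by positivity
    linarith
  have k1 : (1 + N) * (T * (U * b₁)) ≤ (c₂ + 1 + C₁ + N * c₄ + N + M * 2 ^ (q - 1) + C₂ + M)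
      * (T * (U * b₁)) := by
    refine mul_le_mul_of_nonneg_right ?_ p1
    have : 0 ≤ c₂ + C₁ + N * c₄ + M * 2 ^ (q - 1) + C₂ + M := by positivity
    linarith
  have k2 : (c₂ + C₁ + N * c₄ + M * 2 ^ (q - 1) + C₂ + M) * (T * V)
      ≤ (c₂ + 1 + C₁ + N * c₄ + N + M * 2 ^ (q - 1) + C₂ + M) * (T * V) := by
    refine mul_le_mul_of_nonneg_right ?_ pTV
    have : (0 : ℝ) ≤ N := by positivity
    linarith
  linarith only [b1, b2', b3, b4, b5, b6, b7, k0, k1, k2]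

end

/-! ### Cutoff functions, truncations and integration of the tested equation. -/

section

open Filter Topology Metric Set
open scoped NNReal

/-- Smooth cutoff functions between concentric balls, with a bound for the gradient. -/
theorem exists_cutoff (n : ℕ) : ∃ C : ℝ, 1 ≤ C ∧ ∀ (x₀ : EuclideanSpace ℝ (Fin n)) (ρ' ρ : ℝ),
    0 < ρ' → ρ' < ρ → ∃ η : EuclideanSpace ℝ (Fin n) → ℝ, ContDiff ℝ ∞ η ∧
      (∀ x, 0 ≤ η x ∧ η x ≤ 1) ∧ (∀ x ∈ ball x₀ ρ', η x = 1) ∧ HasCompactSupport η ∧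
      tsupport η ⊆ ball x₀ ρ ∧ ∀ x, ‖gradient η x‖ ≤ C / (ρ - ρ') := by
  have hS : ContDiff ℝ ∞ Real.smoothTransition := Real.smoothTransition.contDiff (n := ⊤)
  have hS' : Continuous (deriv Real.smoothTransition) := hS.continuous_deriv (by simp)
  have hSc : HasCompactSupport (deriv Real.smoothTransition) := by
    refine HasCompactSupport.intro (isCompact_Icc (a := (0 : ℝ)) (b := 1)) fun t ht => ?_
    rw [mem_Icc, not_and_or, not_le, not_le] at ht
    rcases ht with ht | ht
    · have : Real.smoothTransition =ᶠ[𝓝 t] fun _ => 0 := by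
        filter_upwards [Iio_mem_nhds ht] with s hs
        exact Real.smoothTransition.zero_of_nonpos (le_of_lt hs)
      rw [this.deriv_eq]; simp
    · have : Real.smoothTransition =ᶠ[𝓝 t] fun _ => 1 := by
        filter_upwards [Ioi_mem_nhds ht] with s hs
        exact Real.smoothTransition.one_of_one_le (le_of_lt hs)
      rw [this.deriv_eq]; simp
  obtain ⟨D, hD⟩ := hS'.bounded_above_of_compact_support hSc
  have hD0 : 0 ≤ D := (norm_nonneg _).trans (hD 0)
  -- The summand `1` makes the slope bound `C / (ρ - ρ')` at least one for radii up to one, as the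
  -- absorption lemma requires.
  refine ⟨4 * D + 1, by linarith, fun x₀ ρ' ρ hρ' hρ => ?_⟩
  set R := (ρ + ρ') / 2 with hR
  have hR1 : ρ' < R := by linarith
  have hR2 : R < ρ := by linarith
  have hR0 : 0 < R := hρ'.trans hR1
  have hden : 0 < R ^ 2 - ρ' ^ 2 := by nlinarith
  -- The squared distance is smooth at the centre too. For `‖x - x₀‖ ≤ R` its slope is at most `2 *
  -- R / (R ^ 2 - ρ' ^ 2) ≤ 4 / (ρ - ρ')`, as `R` is the midpoint of `ρ'` and `ρ`.
  let f : EuclideanSpace ℝ (Fin n) → ℝ := fun x => (R ^ 2 - ‖x - x₀‖ ^ 2) / (R ^ 2 - ρ' ^ 2)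
  let η : EuclideanSpace ℝ (Fin n) → ℝ := fun x => Real.smoothTransition (f x)
  have hf : ContDiff ℝ ∞ f :=
    (contDiff_const.sub ((contDiff_id.sub contDiff_const).norm_sq ℝ)).div_const _
  have hη : ContDiff ℝ ∞ η := hS.comp hf
  have hz : ∀ x ∉ closedBall x₀ R, η x = 0 := by
    intro x hx
    rw [mem_closedBall, not_le, dist_eq_norm] at hx
    exact Real.smoothTransition.zero_of_nonpos
      (div_nonpos_of_nonpos_of_nonneg (by nlinarith) hden.le)
  have hsupp : tsupport η ⊆ closedBall x₀ R := by
    refine closure_minimal (fun x hx => ?_) isClosed_closedBall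
    by_contra h
    exact hx (hz x h)
  refine ⟨η, hη, fun x => ⟨Real.smoothTransition.nonneg _, Real.smoothTransition.le_one _⟩, ?_,
    HasCompactSupport.intro (isCompact_closedBall x₀ R) hz,
    hsupp.trans (closedBall_subset_ball hR2), fun x => ?_⟩
  · intro x hx
    rw [mem_ball, dist_eq_norm] at hx
    refine Real.smoothTransition.one_of_one_le ?_
    change 1 ≤ (R ^ 2 - ‖x - x₀‖ ^ 2) / (R ^ 2 - ρ' ^ 2)
    rw [one_le_div hden]
    nlinarith [norm_nonneg (x - x₀)]
  · by_cases hx : x ∈ tsupport η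
    · have hxR : ‖x - x₀‖ ≤ R := by
        rw [← dist_eq_norm]; exact hsupp hx
      have h1 : HasFDerivAt (fun x => ‖x - x₀‖ ^ 2)
          ((2 : ℕ) • (innerSL ℝ (x - x₀)).comp (ContinuousLinearMap.id ℝ (EuclideanSpace ℝ (Fin n)))) x :=
        ((hasFDerivAt_id x).sub_const x₀).norm_sq
      have h2 : HasFDerivAt f ((R ^ 2 - ρ' ^ 2)⁻¹ •
          (-((2 : ℕ) • (innerSL ℝ (x - x₀)).comp (ContinuousLinearMap.id ℝ (EuclideanSpace ℝ (Fin n)))))) x := by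
        have := (h1.const_sub (R ^ 2)).const_mul (R ^ 2 - ρ' ^ 2)⁻¹
        refine this.congr_of_eventuallyEq (Eventually.of_forall fun y => ?_)
        simp only [f]; ring
      have h3 : HasFDerivAt η (deriv Real.smoothTransition (f x) • ((R ^ 2 - ρ' ^ 2)⁻¹ •
          (-((2 : ℕ) • (innerSL ℝ (x - x₀)).comp (ContinuousLinearMap.id ℝ (EuclideanSpace ℝ (Fin n))))))) x :=
        ((hS.differentiable (by simp)) (f x)).hasDerivAt.comp_hasFDerivAt x h2
      rw [norm_gradient, h3.fderiv, norm_smul, norm_smul, norm_neg, ContinuousLinearMap.comp_id,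
        two_smul, ← two_smul ℝ, norm_smul, innerSL_apply_norm, Real.norm_of_nonneg
        (inv_nonneg.2 hden.le), Real.norm_of_nonneg zero_le_two]
      calc ‖deriv Real.smoothTransition (f x)‖ * ((R ^ 2 - ρ' ^ 2)⁻¹ * (2 * ‖x - x₀‖))
          ≤ D * ((R ^ 2 - ρ' ^ 2)⁻¹ * (2 * R)) := by gcongr; exact hD _
        _ = D * (2 * R) / ((R + ρ') * (R - ρ')) := by rw [← sq_sub_sq]; field_simp
        _ ≤ D * (2 * R) / (R * (R - ρ')) := by
          have : 0 < R - ρ' := by linarith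
          gcongr
          linarith
        _ = 4 * D / (ρ - ρ') := by
          have h5 : R - ρ' = (ρ - ρ') / 2 := by rw [hR]; ring
          have h6 : ρ - ρ' ≠ 0 := by linarith
          rw [h5]; field_simp; norm_num
        _ ≤ (4 * D + 1) / (ρ - ρ') := by
          have : 0 < ρ - ρ' := by linarith
          gcongr; linarith
    · rw [gradient_eq_zero_of_notMem_tsupport hx, norm_zero]
      exact div_nonneg (by linarith) (by linarith)

/-- A continuous ramp that vanishes up to level `k` and equals one from level `k'` on. -/
noncomputable def ramp (k k' t : ℝ) : ℝ := max 0 (min 1 ((|t| - k) / (k' - k)))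

/-- The odd primitive of the ramp. -/
noncomputable def rampPrimitive (k k' t : ℝ) : ℝ := ∫ s in (0 : ℝ)..t, ramp k k' s

section Ramp

variable {k k' t : ℝ}

theorem continuous_ramp (k k' : ℝ) : Continuous (ramp k k') := by
  unfold ramp; fun_prop

theorem ramp_nonneg (k k' t : ℝ) : 0 ≤ ramp k k' t := le_max_left _ _

theorem ramp_le_one (k k' t : ℝ) : ramp k k' t ≤ 1 := max_le zero_le_one (min_le_left _ _)

theorem abs_ramp_le_one (k k' t : ℝ) : |ramp k k' t| ≤ 1 := by
  rw [abs_of_nonneg (ramp_nonneg _ _ _)]; exact ramp_le_one _ _ _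

theorem ramp_eq_zero (hk : k < k') (ht : |t| ≤ k) : ramp k k' t = 0 := by
  refine max_eq_left ((min_le_right _ _).trans ?_)
  exact div_nonpos_of_nonpos_of_nonneg (by linarith) (by linarith)

theorem half_le_ramp (hk : k < k') (ht : (k + k') / 2 ≤ |t|) : 1 / 2 ≤ ramp k k' t := by
  refine le_max_of_le_right (le_min (by norm_num) ?_)
  rw [le_div_iff₀ (by linarith)]
  linarith

theorem ramp_mono_abs (hk : k < k') {s : ℝ} (h : |s| ≤ |t|) : ramp k k' s ≤ ramp k k' t := by
  have : 0 < k' - k := by linarith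
  unfold ramp
  gcongr

theorem hasDerivAt_rampPrimitive (k k' t : ℝ) :
    HasDerivAt (rampPrimitive k k') (ramp k k' t) t :=
  intervalIntegral.integral_hasDerivAt_right ((continuous_ramp k k').intervalIntegrable _ _)
    (continuous_ramp k k').stronglyMeasurable.stronglyMeasurableAtFilter
    (continuous_ramp k k').continuousAt

theorem rampPrimitive_zero (k k' : ℝ) : rampPrimitive k k' 0 = 0 := intervalIntegral.integral_same

theorem rampPrimitive_neg (k k' t : ℝ) : rampPrimitive k k' (-t) = -rampPrimitive k k' t := by
  have h : ∀ s, ramp k k' (-s) = ramp k k' s := fun s => by simp [ramp]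
  have := intervalIntegral.integral_comp_neg (f := ramp k k') (a := 0) (b := t)
  simp only [h, neg_zero] at this
  rw [rampPrimitive, rampPrimitive, this, intervalIntegral.integral_symm]

/-- The ramp increases with `|t|`, so its integral is at most its end value times the length.
Keeping the factor `ramp` gives all terms of the tested equation the same weight. -/
theorem abs_rampPrimitive_le (hk : k < k') (t : ℝ) :
    |rampPrimitive k k' t| ≤ ramp k k' t * |t| := by
  have := intervalIntegral.norm_integral_le_of_norm_le_const (f := ramp k k') (a := 0) (b := t)
    (C := ramp k k' t) fun s hs => by
      rw [Real.norm_of_nonneg (ramp_nonneg _ _ _)]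
      refine ramp_mono_abs hk ?_
      rw [mem_uIoc] at hs
      rcases hs with hs | hs
      · rw [abs_of_pos hs.1, abs_of_nonneg (hs.1.le.trans hs.2)]; exact hs.2
      · rw [abs_of_nonpos hs.2, abs_of_neg (hs.1.trans_le hs.2)]; linarith [hs.1]
  simpa [rampPrimitive] using this

/-- From the midpoint `m` of `k` and `k'` on, the ramp is at least `1 / 2`. The constant is the
value of `(t - m) / (2 * t)` at `t = k'`, where this ratio is smallest; negative `t` follow by
oddness. -/
theorem le_abs_rampPrimitive (hk0 : 0 ≤ k) (hk : k < k') (ht : k' ≤ |t|) :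
    (k' - k) / (4 * k') * |t| ≤ |rampPrimitive k k' t| := by
  have key : ∀ t, k' ≤ t → (k' - k) / (4 * k') * t ≤ rampPrimitive k k' t := by
    intro t ht
    set m := (k + k') / 2 with hm
    have hm0 : 0 ≤ m := by linarith
    have h0 : 0 ≤ rampPrimitive k k' m :=
      intervalIntegral.integral_nonneg hm0 fun s _ => ramp_nonneg _ _ _
    have h1 : rampPrimitive k k' t - rampPrimitive k k' m = ∫ s in m..t, ramp k k' s :=
      intervalIntegral.integral_interval_sub_left ((continuous_ramp k k').intervalIntegrable _ _)
        ((continuous_ramp k k').intervalIntegrable _ _)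
    have h2 : (t - m) * (1 / 2) ≤ ∫ s in m..t, ramp k k' s := by
      have := intervalIntegral.integral_mono_on (μ := volume) (a := m) (b := t)
        (f := fun _ => (1 : ℝ) / 2)
        (g := ramp k k') (by linarith) intervalIntegrable_const
        ((continuous_ramp k k').intervalIntegrable _ _) fun s hs =>
          half_le_ramp hk (hs.1.trans (le_abs_self s))
      simpa using this
    have hk' : 0 < k' := by linarith
    have h3 : (k' - k) / (4 * k') * t ≤ (t - m) * (1 / 2) := by
      rw [div_mul_eq_mul_div, div_le_iff₀ (by positivity)]
      nlinarith
    linarith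
  rcases le_total 0 t with h | h
  · rw [abs_of_nonneg h] at ht ⊢
    exact (key t ht).trans (le_abs_self _)
  · rw [abs_of_nonpos h] at ht ⊢
    have := (key (-t) ht).trans (le_abs_self _)
    rwa [rampPrimitive_neg, abs_neg] at this

end Ramp

/-- If `∫ F = 0` and `f ≤ F + s` with `f, s ≥ 0`, then `∫ f ≤ ∫ s`. -/
theorem lintegral_le_of_integral_eq_zero {α : Type*} [MeasurableSpace α] {μ : Measure α}
    {F f s : α → ℝ} (hF : Integrable F μ) (h0 : ∫ x, F x ∂μ = 0)
    (hf : ∀ᵐ x ∂μ, 0 ≤ f x) (hs : ∀ᵐ x ∂μ, 0 ≤ s x) (h : ∀ᵐ x ∂μ, f x ≤ F x + s x) :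
    ∫⁻ x, ENNReal.ofReal (f x) ∂μ ≤ ∫⁻ x, ENNReal.ofReal (s x) ∂μ := by
  -- The positive and negative parts of `F` have the same finite integral, which is added on one
  -- side and cancelled; neither `f` nor `s` has to be integrable.
  have hpm : ∫⁻ x, ENNReal.ofReal (F x) ∂μ = ∫⁻ x, ENNReal.ofReal (-F x) ∂μ := by
    have h1 := integral_eq_lintegral_pos_part_sub_lintegral_neg_part hF
    rw [h0, eq_comm, sub_eq_zero] at h1
    exact (ENNReal.toReal_eq_toReal_iff' hF.lintegral_lt_top.ne hF.neg.lintegral_lt_top.ne).1 h1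
  have hfin : ∫⁻ x, ENNReal.ofReal (-F x) ∂μ ≠ ⊤ := hF.neg.lintegral_lt_top.ne
  rw [← ENNReal.add_le_add_iff_right hfin]
  calc ∫⁻ x, ENNReal.ofReal (f x) ∂μ + ∫⁻ x, ENNReal.ofReal (-F x) ∂μ
      = ∫⁻ x, (ENNReal.ofReal (f x) + ENNReal.ofReal (-F x)) ∂μ :=
        (lintegral_add_right' _ hF.1.aemeasurable.neg.ennreal_ofReal).symm
    _ ≤ ∫⁻ x, (ENNReal.ofReal (s x) + ENNReal.ofReal (F x)) ∂μ := by
        refine lintegral_mono_ae ?_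
        filter_upwards [hf, hs, h] with x hfx hsx hx
        rcases le_total 0 (F x) with hFx | hFx
        · rw [ENNReal.ofReal_of_nonpos (neg_nonpos.2 hFx), add_zero,
            ← ENNReal.ofReal_add hsx hFx]
          exact ENNReal.ofReal_le_ofReal (by linarith)
        · rw [ENNReal.ofReal_of_nonpos hFx, add_zero]
          rw [← ENNReal.ofReal_add hfx (by linarith)]
          exact ENNReal.ofReal_le_ofReal (by linarith)
    _ = ∫⁻ x, ENNReal.ofReal (s x) ∂μ + ∫⁻ x, ENNReal.ofReal (-F x) ∂μ := by
        rw [lintegral_add_right' _ hF.1.aemeasurable.ennreal_ofReal, hpm]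

end

/-! ### The test function and its pointwise estimate. -/

section

open Filter Topology Metric Set
open scoped NNReal

/-- The vector field `A = a(x, u, Du)` and the function `B = b(x, u, Du)` satisfy the structure
conditions along `u`, whose weak gradient is `G`, and `div A = B` in the weak sense. -/
structure IsStructuredSolution {n : ℕ} (Ω : Set (EuclideanSpace ℝ (Fin n)))
    (p q θ δ c₁ c₂ c₃ c₄ M : ℝ) (A : EuclideanSpace ℝ (Fin n) → EuclideanSpace ℝ (Fin n))
    (B b₀ b₁ u : EuclideanSpace ℝ (Fin n) → ℝ)
    (G : EuclideanSpace ℝ (Fin n) → EuclideanSpace ℝ (Fin n)) : Prop where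
  memW1Loc : MemW1Loc Ω q u G
  b₀_nonneg : ∀ᵐ x ∂(volume.restrict Ω), 0 ≤ b₀ x
  b₁_nonneg : ∀ᵐ x ∂(volume.restrict Ω), 0 ≤ b₁ x
  coercivity : ∀ᵐ x ∂(volume.restrict Ω),
    c₁ * ‖G x‖ ^ p - c₂ * |u x| ^ θ - b₁ x ≤ inner ℝ (A x) (G x)
  growth_a : ∀ᵐ x ∂(volume.restrict Ω),
    ‖A x‖ ≤ c₃ * ‖G x‖ ^ (q - 1) + c₄ * |u x| ^ ((q - 1) * (2 / (q - p + 2))) + b₁ x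
  growth_b : ∀ᵐ x ∂(volume.restrict Ω),
    |B x| ≤ M * (1 + ‖G x‖ ^ 2) ^ ((p + q - 2) / 4) + M * |u x| ^ (δ - 1) + b₀ x
  weak : ∀ (φ : EuclideanSpace ℝ (Fin n) → ℝ)
    (H : EuclideanSpace ℝ (Fin n) → EuclideanSpace ℝ (Fin n)), MemW1 Ω q φ H →
    (∃ K : Set (EuclideanSpace ℝ (Fin n)), IsCompact K ∧ K ⊆ Ω ∧
      ∀ᵐ x ∂(volume.restrict Ω), x ∉ K → φ x = 0) →
    IntegrableOn (fun x => inner ℝ (A x) (H x) + B x * φ x) Ω volume ∧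
      ∫ x in Ω, (inner ℝ (A x) (H x) + B x * φ x) = 0

/-- Only the values of `a` and `b` along `(x, u, Du)` enter the estimates, so the nonlinearity is
frozen into fields `A` and `B`. -/
theorem IsWeakSolution.exists_isStructuredSolution {n : ℕ} {Ω : Set (EuclideanSpace ℝ (Fin n))}
    {p q θ δ s₀ s₁ c₁ c₂ c₃ c₄ M : ℝ}
    {a : EuclideanSpace ℝ (Fin n) → ℝ → EuclideanSpace ℝ (Fin n) → EuclideanSpace ℝ (Fin n)}
    {b : EuclideanSpace ℝ (Fin n) → ℝ → EuclideanSpace ℝ (Fin n) → ℝ}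
    {b₀ b₁ u : EuclideanSpace ℝ (Fin n) → ℝ} (h : IsWeakSolution Ω q a b u)
    (hs : StructureConditions Ω p q θ δ s₀ s₁ c₁ c₂ c₃ c₄ M a b b₀ b₁) :
    ∃ A B G, IsStructuredSolution Ω p q θ δ c₁ c₂ c₃ c₄ M A B b₀ b₁ u G := by
  obtain ⟨G, hG, hw⟩ := h
  refine ⟨fun x => a x (u x) (G x), fun x => b x (u x) (G x), G, hG, hs.b₀_nonneg, hs.b₁_nonneg,
    ?_, ?_, ?_, hw⟩
  · filter_upwards [hs.coercivity] with x hx using hx _ _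
  · filter_upwards [hs.growth_a] with x hx using hx _ _
  · filter_upwards [hs.growth_b] with x hx using hx _ _

section TestFunction

variable {n : ℕ} {Ω : Set (EuclideanSpace ℝ (Fin n))} {q : ℝ} {u : EuclideanSpace ℝ (Fin n) → ℝ}
  {G : EuclideanSpace ℝ (Fin n) → EuclideanSpace ℝ (Fin n)}
  {η : EuclideanSpace ℝ (Fin n) → ℝ} {k k' : ℝ} {N : ℕ}

theorem gradient_pow (hη : ContDiff ℝ ∞ η) (N : ℕ) (x : EuclideanSpace ℝ (Fin n)) :
    gradient (fun x => η x ^ N) x = (N * η x ^ (N - 1)) • gradient η x := by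
  have h := ((hη.differentiable (by simp)) x).hasFDerivAt.pow N
  ext i
  rw [gradient_apply, PiLp.smul_apply, gradient_apply, HasFDerivAt.fderiv h]
  simp

/-- Truncations of `u`, times a test function, have a weak gradient and belong to `L^q`. -/
theorem MemW1Loc.testFunction_mul_rampPrimitive (h : MemW1Loc Ω q u G) (hΩ : IsOpen Ω)
    (hk : k < k') {ζ : EuclideanSpace ℝ (Fin n) → ℝ}
    (hζ : ContDiff ℝ ∞ ζ) (hc : HasCompactSupport ζ) (hs : tsupport ζ ⊆ Ω) :
    HasWeakGradient univ (fun x => ζ x * rampPrimitive k k' (u x))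
      (fun x => ζ x • ramp k k' (u x) • G x + rampPrimitive k k' (u x) • gradient ζ x) ∧
    MemW1 Ω q (fun x => ζ x * rampPrimitive k k' (u x))
      (fun x => ζ x • ramp k k' (u x) • G x + rampPrimitive k k' (u x) • gradient ζ x) := by
  obtain ⟨hw, hu, hG⟩ := h
  obtain ⟨hi, hW⟩ := hw.testFunction_mul_comp hΩ hζ hc hs (hasDerivAt_rampPrimitive k k')
    (continuous_ramp k k') (abs_ramp_le_one k k') (rampPrimitive_zero k k')
  obtain ⟨C, hC⟩ := hζ.continuous.bounded_above_of_compact_support hc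
  obtain ⟨D, hD⟩ := (continuous_gradient hζ).bounded_above_of_compact_support
    (hasCompactSupport_gradient hc)
  have hC0 : 0 ≤ C := (norm_nonneg _).trans (hC 0)
  have hgu : ∀ t, ‖rampPrimitive k k' t‖ ≤ ‖t‖ := fun t =>
    (abs_rampPrimitive_le hk t).trans (mul_le_of_le_one_left (abs_nonneg _) (ramp_le_one _ _ _))
  have hext : ∀ {F : Type} [NormedAddCommGroup F] {f : EuclideanSpace ℝ (Fin n) → F},
      (∀ x ∉ tsupport ζ, f x = 0) → MemLp f (ENNReal.ofReal q) (volume.restrict (tsupport ζ)) →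
      MemLp f (ENNReal.ofReal q) (volume.restrict Ω) := by
    intro F _ f hf hL
    rw [← memLp_indicator_iff_restrict (isClosed_tsupport ζ).measurableSet] at hL
    rw [indicator_eq_self.2 fun x hx => by by_contra h; exact hx (hf x h)] at hL
    exact hL.restrict _
  refine ⟨hW, hW.mono, hext ?_ ?_, hext ?_ ?_⟩
  · intro x hx
    rw [image_eq_zero_of_notMem_tsupport hx, zero_mul]
  · refine ((hu _ hc hs).norm.const_mul C).mono hi.1.restrict (Eventually.of_forall fun x => ?_)
    rw [norm_mul, norm_mul, norm_norm, Real.norm_of_nonneg hC0]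
    exact mul_le_mul (hC x) (hgu _) (norm_nonneg _) hC0
  · intro x hx
    rw [image_eq_zero_of_notMem_tsupport hx, gradient_eq_zero_of_notMem_tsupport hx]
    simp
  · refine (((hG _ hc hs).norm.const_mul C).add ((hu _ hc hs).norm.const_mul D)).mono
      (locallyIntegrableOn_univ.1 hW.2).aestronglyMeasurable.restrict
      (Eventually.of_forall fun x => ?_)
    refine (norm_add_le _ _).trans (le_trans ?_ (le_abs_self _))
    rw [norm_smul, norm_smul, norm_smul, Pi.add_apply]
    refine add_le_add ?_ ?_
    · refine mul_le_mul (hC x) ?_ (by positivity) hC0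
      exact mul_le_of_le_one_left (norm_nonneg _) (abs_ramp_le_one _ _ _)
    · rw [mul_comm]
      exact mul_le_mul (hD x) (hgu _) (norm_nonneg _) ((norm_nonneg _).trans (hD x))

end TestFunction

/-- The lower order terms on the superlevel set `{|u| > k}`. -/
noncomputable def superlevelTerm {X : Type*} (lam k : ℝ) (u b₀ b₁ : X → ℝ) (x : X) : ℝ :=
  if k < |u x| then |u x| ^ lam + |u x| * (b₀ x + b₁ x) else 0

theorem superlevelTerm_nonneg {X : Type*} {lam k : ℝ} {u b₀ b₁ : X → ℝ} {x : X} (h₀ : 0 ≤ b₀ x)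
    (h₁ : 0 ≤ b₁ x) : 0 ≤ superlevelTerm lam k u b₀ b₁ x := by
  unfold superlevelTerm
  split_ifs <;> positivity

/-- The gradient of the test function is controlled by the equation and lower order terms. -/
theorem exists_pointwise_const {p q θ δ s₀ s₁ pstar lam : ℝ}
    (h : IterationExponents p q θ δ s₀ s₁ pstar lam) {c₁ c₂ c₃ c₄ M : ℝ} (hc₁ : 0 < c₁)
    (hc₂ : 0 < c₂) (hc₃ : 0 < c₃) (hc₄ : 0 < c₄) (hM : 0 < M) {N : ℕ} (hN : p / (p - q + 1) ≤ N) :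
    ∃ C, 0 ≤ C ∧ ∀ (E : Type) [NormedAddCommGroup E] [InnerProductSpace ℝ E] (η B U b₀ b₁ m g L : ℝ)
      (A G Z : E),
      0 ≤ η → η ≤ 1 → 1 ≤ U → 1 ≤ L → 0 ≤ b₀ → 0 ≤ b₁ → 0 ≤ m → m ≤ 1 → |g| ≤ m * U →
      ‖Z‖ ≤ N * η ^ (N - 1) * L →
      c₁ * ‖G‖ ^ p - c₂ * U ^ θ - b₁ ≤ inner ℝ A G →
      ‖A‖ ≤ c₃ * ‖G‖ ^ (q - 1) + c₄ * U ^ ((q - 1) * (2 / (q - p + 2))) + b₁ →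
      |B| ≤ M * (1 + ‖G‖ ^ 2) ^ ((p + q - 2) / 4) + M * U ^ (δ - 1) + b₀ →
      c₁ / 2 / 2 ^ p * ‖η ^ N • m • G + g • Z‖ ^ p
        ≤ inner ℝ A (η ^ N • m • G + g • Z) + B * (η ^ N * g)
          + C * L ^ (p / (p - q + 1)) * (U ^ lam + U * (b₀ + b₁)) := by
  obtain ⟨C, hC, habs⟩ := exists_absorption_const h hc₁ hc₂ hc₃ hc₄ hM hN
  have hp := h.one_le_p
  have hp0 : 0 < p := by linarith
  have hq1 : 1 ≤ q := hp.trans h.p_le_q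
  set τ := p / (p - q + 1) with hτ
  have hqτ : q ≤ τ := h.q_le_div
  have hτ1 : 1 ≤ τ := hq1.trans hqτ
  have hN0 : (0 : ℝ) < N := by linarith
  -- `C` comes from absorption; the second term pays for the part `g • Z` of the gradient of the
  -- test function.
  refine ⟨C + c₁ / 2 * N ^ p, by positivity, ?_⟩
  intro E _ _ η B U b₀ b₁ m g L A G Z hη hη1 hU hL hb₀ hb₁ hm hm1 hg hZ hco hA hB
  have hU0 : 0 < U := by linarith
  have hL0 : 0 < L := by linarith
  have hζ0 : 0 ≤ η ^ N := by positivity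
  have hζ1 : η ^ N ≤ 1 := pow_le_one₀ hη hη1
  have hζ'1 : η ^ (N - 1) ≤ 1 := pow_le_one₀ hη hη1
  have h0 := habs η ‖G‖ U L b₀ b₁ hη hη1 (norm_nonneg _) hU hL hb₀ hb₁
  have i1 : -(m * (U * (N * η ^ (N - 1) * L)
        * (c₃ * ‖G‖ ^ (q - 1) + c₄ * U ^ ((q - 1) * (2 / (q - p + 2))) + b₁)))
      ≤ g * inner ℝ A Z := by
    refine neg_le_of_abs_le ?_
    rw [abs_mul]
    calc |g| * |inner ℝ A Z| ≤ m * U * (‖A‖ * ‖Z‖) := by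
          gcongr; exact abs_real_inner_le_norm A Z
      _ ≤ m * U * ((c₃ * ‖G‖ ^ (q - 1) + c₄ * U ^ ((q - 1) * (2 / (q - p + 2))) + b₁)
          * (N * η ^ (N - 1) * L)) := by gcongr
      _ = _ := by ring
  have i2 : -(m * (U * η ^ N
        * (M * (1 + ‖G‖ ^ 2) ^ ((p + q - 2) / 4) + M * U ^ (δ - 1) + b₀)))
      ≤ B * (η ^ N * g) := by
    refine neg_le_of_abs_le ?_
    rw [abs_mul, abs_mul, abs_of_nonneg hζ0]
    calc |B| * (η ^ N * |g|) ≤ (M * (1 + ‖G‖ ^ 2) ^ ((p + q - 2) / 4) + M * U ^ (δ - 1) + b₀)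
          * (η ^ N * (m * U)) := by gcongr
      _ = _ := by ring
  have i3 : m * (η ^ N * (c₁ * ‖G‖ ^ p - c₂ * U ^ θ - b₁)) ≤ η ^ N * (m * inner ℝ A G) := by
    calc _ = η ^ N * m * (c₁ * ‖G‖ ^ p - c₂ * U ^ θ - b₁) := by ring
      _ ≤ η ^ N * m * inner ℝ A G := by gcongr
      _ = _ := by ring
  have i4 : inner ℝ A (η ^ N • m • G + g • Z) = η ^ N * (m * inner ℝ A G) + g * inner ℝ A Z := by
    simp [inner_add_right, inner_smul_right]
  set V := U ^ lam + U * (b₀ + b₁) with hV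
  have hV0 : 0 ≤ V := by positivity
  have hT0 : 0 ≤ L ^ τ := by positivity
  have i5 : m * (C * L ^ τ * V) ≤ C * L ^ τ * V := mul_le_of_le_one_left (by positivity) hm1
  have i6 : ‖η ^ N • m • G + g • Z‖ ^ p
      ≤ 2 ^ p * (m * (η ^ N * ‖G‖ ^ p) + N ^ p * (L ^ τ * V)) := by
    have j1 : ‖η ^ N • m • G + g • Z‖ ≤ η ^ N * m * ‖G‖ + N * (L * U) := by
      refine (norm_add_le _ _).trans ?_
      rw [norm_smul, norm_smul, norm_smul, Real.norm_of_nonneg hζ0, Real.norm_of_nonneg hm,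
        Real.norm_eq_abs]
      have : |g| * ‖Z‖ ≤ N * (L * U) := by
        calc |g| * ‖Z‖ ≤ m * U * (N * η ^ (N - 1) * L) := by gcongr
          _ ≤ 1 * U * (N * 1 * L) := by gcongr
          _ = _ := by ring
      linarith
    -- The weight `η ^ N * m` lies in `[0, 1]` and `p ≥ 1`, so its `p`-th power is at most the
    -- weight of the coercive term.
    have j2 : (η ^ N * m * ‖G‖) ^ p ≤ m * (η ^ N * ‖G‖ ^ p) := by
      rw [Real.mul_rpow (by positivity) (norm_nonneg _), ← mul_assoc, mul_comm m]
      gcongr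
      have : η ^ N * m ≤ 1 := mul_le_one₀ hζ1 hm hm1
      exact Real.rpow_le_self_of_le_one (by positivity) this hp
    have j3 : (N * (L * U)) ^ p ≤ N ^ p * (L ^ τ * V) := by
      rw [Real.mul_rpow hN0.le (by positivity), Real.mul_rpow hL0.le hU0.le]
      gcongr
      · exact h.p_le_q.trans hqτ
      · have : U ^ p ≤ U ^ lam := Real.rpow_le_rpow_of_exponent_le hU
          ((h.p_le_q.trans hqτ).trans h.le_lam)
        have h2 : 0 ≤ U * (b₀ + b₁) := by positivity
        linarith
    have j4 : ∀ {s t : ℝ}, 0 ≤ s → 0 ≤ t → (s + t) ^ p ≤ 2 ^ p * (s ^ p + t ^ p) := by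
      intro s t hs ht
      have hsp : 0 ≤ s ^ p := by positivity
      have htp : 0 ≤ t ^ p := by positivity
      have h2 : (0 : ℝ) ≤ 2 ^ p := by positivity
      rcases le_total s t with hst | hst
      · calc (s + t) ^ p ≤ (2 * t) ^ p := by gcongr; linarith
          _ = 2 ^ p * t ^ p := Real.mul_rpow (by norm_num) ht
          _ ≤ _ := by gcongr; linarith
      · calc (s + t) ^ p ≤ (2 * s) ^ p := by gcongr; linarith
          _ = 2 ^ p * s ^ p := Real.mul_rpow (by norm_num) hs
          _ ≤ _ := by gcongr; linarith
    calc _ ≤ (η ^ N * m * ‖G‖ + N * (L * U)) ^ p := by gcongr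
      _ ≤ 2 ^ p * ((η ^ N * m * ‖G‖) ^ p + (N * (L * U)) ^ p) := j4 (by positivity) (by positivity)
      _ ≤ _ := by gcongr
  have i7 : c₁ / 2 / 2 ^ p * ‖η ^ N • m • G + g • Z‖ ^ p
      ≤ m * (c₁ / 2 * (η ^ N * ‖G‖ ^ p)) + c₁ / 2 * N ^ p * L ^ τ * V := by
    calc _ ≤ c₁ / 2 / 2 ^ p * (2 ^ p * (m * (η ^ N * ‖G‖ ^ p) + N ^ p * (L ^ τ * V))) := by gcongr
      _ = _ := by field_simp
  -- All terms carry the factor `m`, so the absorption inequality is used multiplied by it; `m ≤ 1`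
  -- then removes it from the remainder.
  have i8 := mul_le_mul_of_nonneg_left h0 hm
  rw [i4]
  linarith only [i1, i2, i3, i5, i7, i8]

end

/-! ### The energy estimate on superlevel sets. -/

section

open Filter Topology Metric Set
open scoped NNReal

/-- The integral of `|u|^{p*}` over the part of the ball where `|u| > k`. -/
noncomputable def superlevelMass {n : ℕ} (pstar : ℝ) (u : EuclideanSpace ℝ (Fin n) → ℝ)
    (x₀ : EuclideanSpace ℝ (Fin n)) (k ρ : ℝ) : ℝ≥0∞ :=
  ∫⁻ x in ball x₀ ρ, {y | k < |u y|}.indicator (fun y => ‖u y‖ₑ ^ pstar) x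

/-- The energy estimate on superlevel sets. -/
theorem exists_energy_const {n : ℕ} (hn : 0 < n) {p q θ δ s₀ s₁ pstar lam pt : ℝ}
    (h : IterationExponents p q θ δ s₀ s₁ pstar lam) (hpt : 1 ≤ pt) (hptp : pt ≤ p)
    (hps : pstar⁻¹ = pt⁻¹ - (n : ℝ)⁻¹) {c₁ c₂ c₃ c₄ M : ℝ} (hc₁ : 0 < c₁)
    (hc₂ : 0 < c₂) (hc₃ : 0 < c₃) (hc₄ : 0 < c₄) (hM : 0 < M) :
    ∃ C : ℝ, 0 < C ∧ ∀ (Ω : Set (EuclideanSpace ℝ (Fin n)))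
      (A : EuclideanSpace ℝ (Fin n) → EuclideanSpace ℝ (Fin n))
      (B b₀ b₁ u : EuclideanSpace ℝ (Fin n) → ℝ)
      (G : EuclideanSpace ℝ (Fin n) → EuclideanSpace ℝ (Fin n)), IsOpen Ω →
      IsStructuredSolution Ω p q θ δ c₁ c₂ c₃ c₄ M A B b₀ b₁ u G →
      ∀ (x₀ : EuclideanSpace ℝ (Fin n)) (ρ' ρ k k' : ℝ), 0 < ρ' → ρ' < ρ → ρ ≤ 1 →
      ball x₀ ρ ⊆ Ω → 1 ≤ k → k < k' →
      ENNReal.ofReal ((k' - k) / (4 * k')) ^ p * superlevelMass pstar u x₀ k' ρ' ^ (p / pstar)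
        ≤ ENNReal.ofReal (C / (ρ - ρ') ^ (p / (p - q + 1)))
          * ∫⁻ x in ball x₀ ρ, ENNReal.ofReal (superlevelTerm lam k u b₀ b₁ x) := by
  have hp := h.one_le_p
  have hp0 : 0 < p := by linarith
  have hd : 0 < p - q + 1 := by linarith [h.q_lt]
  have hτ1 : 1 ≤ p / (p - q + 1) := (hp.trans h.p_le_q).trans h.q_le_div
  have hP0 : 0 < pstar := by linarith [h.lam_lt, h.le_lam]
  set τ := p / (p - q + 1) with hτ
  obtain ⟨N, hN⟩ := exists_nat_ge τ
  obtain ⟨D, hD, hcut⟩ := exists_cutoff n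
  obtain ⟨K, hK, hpw⟩ := exists_pointwise_const h hc₁ hc₂ hc₃ hc₄ hM hN
  obtain ⟨S, hS⟩ := exists_sobolev_const (n := n) hn hpt hptp hP0 hps
  set κ := c₁ / 2 / 2 ^ p with hκ
  have hκ0 : 0 < κ := by positivity
  refine ⟨(S : ℝ) ^ p * (κ⁻¹ * (K * D ^ τ)) + 1, by positivity, ?_⟩
  intro Ω A B b₀ b₁ u G hΩ hsol x₀ ρ' ρ k k' hρ' hρ hρ1 hball hk hkk'
  have hdρ : 0 < ρ - ρ' := by linarith
  obtain ⟨η, hη, hη01, hη1, hηc, hηs, hηg⟩ := hcut x₀ ρ' ρ hρ' hρ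
  set L := D / (ρ - ρ') with hL
  have hL1 : 1 ≤ L := by
    rw [hL, one_le_div hdρ]; linarith
  have hN0 : N ≠ 0 := by
    rintro rfl
    simp at hN; linarith
  have hζ : ContDiff ℝ ∞ fun x => η x ^ N := hη.pow N
  have hζs : tsupport (fun x => η x ^ N) ⊆ tsupport η := by
    refine closure_mono fun x hx h0 => hx ?_
    simp [h0, hN0]
  have hζc : HasCompactSupport fun x => η x ^ N :=
    hηc.comp_left (g := fun t : ℝ => t ^ N) (by simp [hN0])
  obtain ⟨hW, hW1⟩ := hsol.memW1Loc.testFunction_mul_rampPrimitive (k := k) (k' := k') hΩ hkk' hζ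
    hζc ((hζs.trans hηs).trans hball)
  set φ : EuclideanSpace ℝ (Fin n) → ℝ := fun x => η x ^ N * rampPrimitive k k' (u x) with hφ
  set H : EuclideanSpace ℝ (Fin n) → EuclideanSpace ℝ (Fin n) := fun x =>
    η x ^ N • ramp k k' (u x) • G x
      + rampPrimitive k k' (u x) • gradient (fun x => η x ^ N) x with hH
  have hφ0 : ∀ x ∉ tsupport η, φ x = 0 := fun x hx => by
    simp only [hφ, image_eq_zero_of_notMem_tsupport hx, zero_pow hN0, zero_mul]
  have hH0 : ∀ x ∉ tsupport η, H x = 0 := fun x hx => by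
    simp only [hH, image_eq_zero_of_notMem_tsupport hx,
      gradient_eq_zero_of_notMem_tsupport fun h' => hx (hζs h'), zero_pow hN0, zero_smul,
      smul_zero, add_zero]
  obtain ⟨hF, hF0⟩ := hsol.weak φ H hW1 ⟨tsupport η, hηc, hηs.trans hball,
    Eventually.of_forall hφ0⟩
  set T := superlevelTerm lam k u b₀ b₁ with hT
  have hT0 : ∀ᵐ x ∂(volume.restrict Ω), 0 ≤ T x := by
    filter_upwards [hsol.b₀_nonneg, hsol.b₁_nonneg] with x h0 h1 using superlevelTerm_nonneg h0 h1
  -- The pointwise estimate, integrated against the weak equation. Where `|u| > k` it applies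
  -- because `k ≥ 1`; where `|u| ≤ k` both `φ` and `H` vanish, so only the superlevel set
  -- contributes.
  have key : ∫⁻ x in Ω, ENNReal.ofReal (κ * ‖H x‖ ^ p)
      ≤ ∫⁻ x in Ω, ENNReal.ofReal ((ball x₀ ρ).indicator (fun x => K * L ^ τ * T x) x) := by
    refine lintegral_le_of_integral_eq_zero hF hF0 (Eventually.of_forall fun x => by positivity)
      ?_ ?_
    · filter_upwards [hT0] with x hx
      by_cases hxb : x ∈ ball x₀ ρ
      · rw [indicator_of_mem hxb]; positivity
      · rw [indicator_of_notMem hxb]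
    · filter_upwards [hsol.b₀_nonneg, hsol.b₁_nonneg, hsol.coercivity, hsol.growth_a,
        hsol.growth_b, hT0] with x h0 h1 hco hA hB hTx
      by_cases hx : x ∈ tsupport η
      · rw [indicator_of_mem (hηs hx)]
        rcases lt_or_ge k |u x| with hux | hux
        · have hg := abs_rampPrimitive_le hkk' (u x)
          have hZ : ‖gradient (fun x => η x ^ N) x‖ ≤ N * η x ^ (N - 1) * L := by
            have := (hη01 x).1
            rw [gradient_pow hη, norm_smul, Real.norm_of_nonneg (by positivity)]
            gcongr
            exact hηg x
          have := hpw (EuclideanSpace ℝ (Fin n)) (η x) (B x) |u x| (b₀ x) (b₁ x) (ramp k k' (u x))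
            (rampPrimitive k k' (u x)) L (A x) (G x) (gradient (fun x => η x ^ N) x)
            (hη01 x).1 (hη01 x).2 (by linarith) hL1 h0 h1 (ramp_nonneg _ _ _) (ramp_le_one _ _ _)
            hg hZ hco hA hB
          have hTe : T x = |u x| ^ lam + |u x| * (b₀ x + b₁ x) := if_pos hux
          rw [hTe]
          exact this
        · have hr : ramp k k' (u x) = 0 := ramp_eq_zero hkk' hux
          have hrp : rampPrimitive k k' (u x) = 0 := by
            have := abs_rampPrimitive_le hkk' (u x)
            rw [hr, zero_mul] at this
            exact abs_nonpos_iff.1 this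
          have e1 : H x = 0 := by simp [hH, hr, hrp]
          have e2 : φ x = 0 := by simp [hφ, hrp]
          rw [e1, e2, norm_zero, Real.zero_rpow hp0.ne', inner_zero_right]
          have : 0 ≤ K * L ^ τ * T x := by positivity
          linarith
      · rw [hφ0 x hx, hH0 x hx, norm_zero, Real.zero_rpow hp0.ne', inner_zero_right]
        have : 0 ≤ (ball x₀ ρ).indicator (fun x => K * L ^ τ * T x) x := by
          by_cases hxb : x ∈ ball x₀ ρ
          · rw [indicator_of_mem hxb]; positivity
          · rw [indicator_of_notMem hxb]
        linarith
  set I := ∫⁻ x in ball x₀ ρ, ENNReal.ofReal (T x) with hI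
  have hR : ∫⁻ x in Ω, ENNReal.ofReal ((ball x₀ ρ).indicator (fun x => K * L ^ τ * T x) x)
      = ENNReal.ofReal (K * L ^ τ) * I := by
    have : ∀ x, ENNReal.ofReal ((ball x₀ ρ).indicator (fun x => K * L ^ τ * T x) x)
        = (ball x₀ ρ).indicator (fun x => ENNReal.ofReal (K * L ^ τ) * ENNReal.ofReal (T x)) x := by
      intro x
      by_cases hx : x ∈ ball x₀ ρ
      · rw [indicator_of_mem hx, indicator_of_mem hx, ENNReal.ofReal_mul (by positivity)]
      · rw [indicator_of_notMem hx, indicator_of_notMem hx, ENNReal.ofReal_zero]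
    simp only [this]
    rw [lintegral_indicator measurableSet_ball, Measure.restrict_restrict measurableSet_ball,
      inter_eq_self_of_subset_left hball, lintegral_const_mul' _ _ ENNReal.ofReal_ne_top]
  have hHl : ∫⁻ x in Ω, ENNReal.ofReal (κ * ‖H x‖ ^ p)
      = ENNReal.ofReal κ * ∫⁻ x, ‖H x‖ₑ ^ p := by
    have e1 : ∀ x, ENNReal.ofReal (κ * ‖H x‖ ^ p) = ENNReal.ofReal κ * ‖H x‖ₑ ^ p := by
      intro x
      rw [ENNReal.ofReal_mul hκ0.le, ← ENNReal.ofReal_rpow_of_nonneg (norm_nonneg _) hp0.le,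
        ofReal_norm]
    simp only [e1]
    rw [lintegral_const_mul' _ _ ENNReal.ofReal_ne_top]
    congr 1
    refine setLIntegral_eq_of_support_subset fun x hx => hball (hηs ?_)
    by_contra h'
    simp [hH0 x h', hp0] at hx
  rw [hR, hHl] at key
  have hoff : ∀ x ∉ closedBall x₀ 1, x ∉ tsupport η := fun x hx h' =>
    hx ((ball_subset_closedBall.trans (closedBall_subset_closedBall hρ1)) (hηs h'))
  have hsob := hS x₀ φ H hW (fun x hx => hφ0 x (hoff x hx)) fun x hx => hH0 x (hoff x hx)
  rw [eLpNorm_eq_lintegral_rpow_enorm_toReal (by simpa using hP0) ENNReal.ofReal_ne_top,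
    eLpNorm_eq_lintegral_rpow_enorm_toReal (by simpa using hp0) ENNReal.ofReal_ne_top,
    ENNReal.toReal_ofReal hP0.le, ENNReal.toReal_ofReal hp0.le] at hsob
  -- In the inner ball `η = 1`, so there `φ` is comparable to `u` wherever `|u| > k'`.
  have hlow : ENNReal.ofReal ((k' - k) / (4 * k')) ^ pstar * superlevelMass pstar u x₀ k' ρ'
      ≤ ∫⁻ x, ‖φ x‖ₑ ^ pstar := by
    rw [superlevelMass, ← lintegral_const_mul' _ _
      (ENNReal.rpow_ne_top_of_nonneg hP0.le ENNReal.ofReal_ne_top)]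
    refine le_trans (setLIntegral_mono' measurableSet_ball fun x hx => ?_)
      (setLIntegral_le_lintegral (ball x₀ ρ') fun x => ‖φ x‖ₑ ^ pstar)
    by_cases hux : k' < |u x|
    · rw [indicator_of_mem (show x ∈ {y | k' < |u y|} from hux),
        ← ENNReal.mul_rpow_of_nonneg _ _ hP0.le]
      refine ENNReal.rpow_le_rpow ?_ hP0.le
      simp only [hφ]
      rw [hη1 x hx, one_pow, one_mul, ← ofReal_norm, ← ofReal_norm,
        ← ENNReal.ofReal_mul (div_nonneg (by linarith) (by linarith))]
      exact ENNReal.ofReal_le_ofReal (le_abs_rampPrimitive (by linarith) hkk' hux.le)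
    · rw [indicator_of_notMem (show x ∉ {y | k' < |u y|} from hux), mul_zero]
      exact zero_le
  have hκt : ENNReal.ofReal κ ≠ ⊤ := ENNReal.ofReal_ne_top
  have hκz : ENNReal.ofReal κ ≠ 0 := by simpa using hκ0
  calc ENNReal.ofReal ((k' - k) / (4 * k')) ^ p * superlevelMass pstar u x₀ k' ρ' ^ (p / pstar)
      = (ENNReal.ofReal ((k' - k) / (4 * k')) ^ pstar * superlevelMass pstar u x₀ k' ρ')
          ^ (p / pstar) := by
        rw [ENNReal.mul_rpow_of_nonneg _ _ (by positivity), ← ENNReal.rpow_mul,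
          mul_div_cancel₀ _ hP0.ne']
    _ ≤ (∫⁻ x, ‖φ x‖ₑ ^ pstar) ^ (p / pstar) := ENNReal.rpow_le_rpow hlow (by positivity)
    _ = ((∫⁻ x, ‖φ x‖ₑ ^ pstar) ^ (1 / pstar)) ^ p := by
        rw [← ENNReal.rpow_mul]; congr 1; ring
    _ ≤ (S * (∫⁻ x, ‖H x‖ₑ ^ p) ^ (1 / p)) ^ p := ENNReal.rpow_le_rpow hsob hp0.le
    _ = (S : ℝ≥0∞) ^ p * ∫⁻ x, ‖H x‖ₑ ^ p := by
        rw [ENNReal.mul_rpow_of_nonneg _ _ hp0.le, ← ENNReal.rpow_mul, one_div,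
          inv_mul_cancel₀ hp0.ne', ENNReal.rpow_one]
    _ ≤ (S : ℝ≥0∞) ^ p * (ENNReal.ofReal (κ⁻¹ * (K * L ^ τ)) * I) := by
        gcongr
        rw [ENNReal.ofReal_mul (inv_nonneg.2 hκ0.le), ENNReal.ofReal_inv_of_pos hκ0, mul_assoc,
          ← ENNReal.div_eq_inv_mul, ENNReal.le_div_iff_mul_le (Or.inl hκz) (Or.inl hκt), mul_comm]
        exact key
    _ = ENNReal.ofReal ((S : ℝ) ^ p * (κ⁻¹ * (K * L ^ τ))) * I := by
        rw [ENNReal.ofReal_mul (p := (S : ℝ) ^ p) (by positivity),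
          ← ENNReal.ofReal_rpow_of_nonneg (by positivity)
          hp0.le, ENNReal.ofReal_coe_nnreal, mul_assoc]
    _ ≤ _ := by
        gcongr
        rw [hL, Real.div_rpow (by linarith) hdρ.le, le_div_iff₀ (by positivity)]
        have : (ρ - ρ') ^ τ ≠ 0 := by positivity
        calc _ = (S : ℝ) ^ p * (κ⁻¹ * (K * D ^ τ)) := by field_simp
          _ ≤ _ := by linarith

end

/-! ### Hölder estimates on superlevel sets and geometric decay. -/

section

open Filter Topology Metric Set
open scoped NNReal

/-- Raising a lower power to `P` above level `k` gains the nonpositive power `k ^ (e - P)`; this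
gain is what a high starting level exploits. -/
theorem enorm_rpow_le_of_lt {k e P t : ℝ} (hk : 0 < k) (he : e ≤ P) (ht : k < |t|) :
    ‖t‖ₑ ^ e ≤ ENNReal.ofReal (k ^ (e - P)) * ‖t‖ₑ ^ P := by
  have ht0 : 0 < |t| := hk.trans ht
  rw [Real.enorm_eq_ofReal_abs, ENNReal.ofReal_rpow_of_pos ht0, ENNReal.ofReal_rpow_of_pos ht0,
    ← ENNReal.ofReal_mul (by positivity)]
  refine ENNReal.ofReal_le_ofReal ?_
  calc |t| ^ e = |t| ^ (e - P) * |t| ^ P := by rw [← Real.rpow_add ht0]; congr 1; ring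
    _ ≤ _ := by
      refine mul_le_mul_of_nonneg_right ?_ (by positivity)
      exact Real.rpow_le_rpow_of_nonpos hk ht.le (sub_nonpos.2 he)

section Superlevel

variable {α : Type*} [MeasurableSpace α] {μ : Measure α} {u b : α → ℝ}

theorem aemeasurable_superlevel (hu : AEMeasurable u μ) (k e : ℝ) :
    AEMeasurable (fun x => {y | k < |u y|}.indicator (fun y => ‖u y‖ₑ ^ e) x) μ := by
  have h : Measurable fun t : ℝ => {t : ℝ | k < |t|}.indicator (fun t => ‖t‖ₑ ^ e) t :=
    (measurable_enorm.pow_const e).indicator (measurableSet_lt measurable_const measurable_norm)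
  exact h.comp_aemeasurable hu

/-- Hölder's inequality on the superlevel set `{|u| > k}`. -/
theorem lintegral_superlevel_mul_le (hu : AEMeasurable u μ) (hb : AEMeasurable b μ)
    {s P lam k : ℝ} (hs : 1 < s) (hP : 1 ≤ P * (1 - 1 / s)) (hlam : P / s + 1 ≤ lam)
    (hk : 1 ≤ k) :
    ∫⁻ x, {y | k < |u y|}.indicator (fun y => ‖u y‖ₑ * ‖b y‖ₑ) x ∂μ
      ≤ ENNReal.ofReal (k ^ (lam - P)) * (eLpNorm b (ENNReal.ofReal s) μ
        * (∫⁻ x, {y | k < |u y|}.indicator (fun y => ‖u y‖ₑ ^ P) x ∂μ) ^ (1 - 1 / s)) := by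
  have hs0 : 0 < s := by linarith
  have hk0 : 0 < k := by linarith
  set Y := ∫⁻ x, {y | k < |u y|}.indicator (fun y => ‖u y‖ₑ ^ P) x ∂μ with hY
  set t := Real.conjExponent s with ht
  have hst : s.HolderConjugate t := Real.HolderConjugate.conjExponent hs
  have ht1 : 1 / t = 1 - 1 / s := by
    rw [one_div, one_div, eq_sub_iff_add_eq']; exact hst.inv_add_inv_eq_one
  have ht0 : 0 < t := hst.symm.pos
  have htP : t ≤ P := by
    rw [← ht1, mul_one_div, one_le_div ht0] at hP; exact hP
  have h1 := ENNReal.lintegral_mul_le_Lp_mul_Lq μ hst.symm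
    (f := fun x => {y | k < |u y|}.indicator (fun y => ‖u y‖ₑ ^ (1 : ℝ)) x)
    (g := fun x => ‖b x‖ₑ) (aemeasurable_superlevel hu k 1) hb.enorm
  have h2 : ∀ x, ((fun x => {y | k < |u y|}.indicator (fun y => ‖u y‖ₑ ^ (1 : ℝ)) x)
      * fun x => ‖b x‖ₑ) x = {y | k < |u y|}.indicator (fun y => ‖u y‖ₑ * ‖b y‖ₑ) x := by
    intro x
    by_cases hx : x ∈ {y | k < |u y|}
    · simp only [Pi.mul_apply, indicator_of_mem hx, ENNReal.rpow_one]
    · simp only [Pi.mul_apply, indicator_of_notMem hx, zero_mul]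
  have h3 : ∫⁻ x, {y | k < |u y|}.indicator (fun y => ‖u y‖ₑ ^ (1 : ℝ)) x ^ t ∂μ
      ≤ ENNReal.ofReal (k ^ (t - P)) * Y := by
    rw [hY, ← lintegral_const_mul' _ _ ENNReal.ofReal_ne_top]
    refine lintegral_mono fun x => ?_
    by_cases hx : x ∈ {y | k < |u y|}
    · simp only [indicator_of_mem hx, ENNReal.rpow_one]
      exact enorm_rpow_le_of_lt hk0 htP hx
    · simp only [indicator_of_notMem hx, mul_zero]
      rw [ENNReal.zero_rpow_of_pos ht0]
  have h4 : eLpNorm b (ENNReal.ofReal s) μ = (∫⁻ x, ‖b x‖ₑ ^ s ∂μ) ^ (1 / s) := by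
    rw [eLpNorm_eq_lintegral_rpow_enorm_toReal (by simpa using hs0) ENNReal.ofReal_ne_top,
      ENNReal.toReal_ofReal hs0.le]
  simp only [h2] at h1
  rw [h4]
  refine h1.trans ?_
  calc _ ≤ (ENNReal.ofReal (k ^ (t - P)) * Y) ^ (1 / t) * (∫⁻ x, ‖b x‖ₑ ^ s ∂μ) ^ (1 / s) := by
        gcongr
    _ = ENNReal.ofReal ((k ^ (t - P)) ^ (1 / t))
          * ((∫⁻ x, ‖b x‖ₑ ^ s ∂μ) ^ (1 / s) * Y ^ (1 / t)) := by
        rw [ENNReal.mul_rpow_of_nonneg _ _ (by positivity),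
          ENNReal.ofReal_rpow_of_nonneg (by positivity) (by positivity)]
        ring
    _ ≤ _ := by
        rw [← ht1]
        gcongr
        rw [← Real.rpow_mul hk0.le]
        refine Real.rpow_le_rpow_of_exponent_le hk ?_
        -- Hölder leaves this power of `k`. It is at most `lam - P` exactly when `P / s + 1 ≤ lam`,
        -- whence these entries in the definition of `σ`.
        have : (t - P) * (1 / t) = 1 - P + P / s := by
          rw [sub_mul, ht1, mul_sub]
          have : t * (1 - 1 / s) = 1 := by rw [← ht1]; field_simp
          linear_combination this
        linarith

end Superlevel

/-- The power `|u| ^ lam` is compared with `|u| ^ pstar` directly, the products with `b₀` and `b₁`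
by Hölder; all three gain the same factor `k ^ (-σ)`. -/
theorem lintegral_superlevelTerm_le {n : ℕ} {p q θ δ s₀ s₁ pstar lam : ℝ}
    (h : IterationExponents p q θ δ s₀ s₁ pstar lam) {u b₀ b₁ : EuclideanSpace ℝ (Fin n) → ℝ}
    {x₀ : EuclideanSpace ℝ (Fin n)} {k ρ : ℝ} (hk : 1 ≤ k)
    (hu : AEMeasurable u (volume.restrict (ball x₀ ρ)))
    (hb₀ : AEMeasurable b₀ (volume.restrict (ball x₀ ρ)))
    (hb₁ : AEMeasurable b₁ (volume.restrict (ball x₀ ρ))) :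
    ∫⁻ x in ball x₀ ρ, ENNReal.ofReal (superlevelTerm lam k u b₀ b₁ x)
      ≤ ENNReal.ofReal (k ^ (lam - pstar)) * (superlevelMass pstar u x₀ k ρ
        + eLpNorm b₀ (ENNReal.ofReal s₀) (volume.restrict (ball x₀ ρ))
          * superlevelMass pstar u x₀ k ρ ^ (1 - 1 / s₀)
        + eLpNorm b₁ (ENNReal.ofReal s₁) (volume.restrict (ball x₀ ρ))
          * superlevelMass pstar u x₀ k ρ ^ (1 - 1 / s₁)) := by
  have hk0 : 0 < k := by linarith
  have hpt : ∀ x, ENNReal.ofReal (superlevelTerm lam k u b₀ b₁ x)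
      ≤ ENNReal.ofReal (k ^ (lam - pstar)) * {y | k < |u y|}.indicator (fun y => ‖u y‖ₑ ^ pstar) x
        + {y | k < |u y|}.indicator (fun y => ‖u y‖ₑ * ‖b₀ y‖ₑ) x
        + {y | k < |u y|}.indicator (fun y => ‖u y‖ₑ * ‖b₁ y‖ₑ) x := by
    intro x
    by_cases hx : k < |u x|
    · have hx' : x ∈ {y | k < |u y|} := hx
      simp only [indicator_of_mem hx', superlevelTerm, if_pos hx]
      calc ENNReal.ofReal (|u x| ^ lam + |u x| * (b₀ x + b₁ x))
          ≤ ENNReal.ofReal (|u x| ^ lam + |u x| * |b₀ x| + |u x| * |b₁ x|) := by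
            refine ENNReal.ofReal_le_ofReal ?_
            nlinarith [mul_le_mul_of_nonneg_left (le_abs_self (b₀ x)) (abs_nonneg (u x)),
              mul_le_mul_of_nonneg_left (le_abs_self (b₁ x)) (abs_nonneg (u x))]
        _ = ‖u x‖ₑ ^ lam + ‖u x‖ₑ * ‖b₀ x‖ₑ + ‖u x‖ₑ * ‖b₁ x‖ₑ := by
            rw [ENNReal.ofReal_add (by positivity) (by positivity),
              ENNReal.ofReal_add (by positivity) (by positivity),
              ENNReal.ofReal_mul (abs_nonneg _), ENNReal.ofReal_mul (abs_nonneg _),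
              ← ENNReal.ofReal_rpow_of_pos (hk0.trans hx)]
            simp only [Real.enorm_eq_ofReal_abs]
        _ ≤ _ := by
            gcongr
            exact enorm_rpow_le_of_lt hk0 h.lam_lt.le hx
    · simp only [superlevelTerm, if_neg hx, ENNReal.ofReal_zero]
      exact zero_le
  refine (lintegral_mono hpt).trans ?_
  have m1 := aemeasurable_superlevel hu k pstar
  have m2 : AEMeasurable (fun x => {y | k < |u y|}.indicator (fun y => ‖u y‖ₑ * ‖b₀ y‖ₑ) x)
      (volume.restrict (ball x₀ ρ)) := by
    refine ((aemeasurable_superlevel hu k 1).mul hb₀.enorm).congr (Eventually.of_forall fun x => ?_)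
    by_cases hx : x ∈ {y | k < |u y|}
    · simp only [Pi.mul_apply, indicator_of_mem hx, ENNReal.rpow_one]
    · simp only [Pi.mul_apply, indicator_of_notMem hx, zero_mul]
  rw [lintegral_add_left' (by exact (m1.const_mul _).add m2),
    lintegral_add_left' (m1.const_mul _),
    lintegral_const_mul' _ _ ENNReal.ofReal_ne_top, mul_add, mul_add]
  have hp := h.one_le_p
  gcongr
  · exact le_rfl
  · exact lintegral_superlevel_mul_le hu hb₀ h.one_lt_s₀ (hp.trans h.lt_s₀.le) h.s₀_le hk
  · exact lintegral_superlevel_mul_le hu hb₁ h.one_lt_s₁ (hp.trans h.lt_s₁.le) h.s₁_le hk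

/-- Fast geometric decay of sequences that satisfy a superlinear recursive inequality. -/
theorem le_geometric_of_superlinear {Y : ℕ → ℝ≥0∞} {s α α₀ α₁ b a X Q N₀ N₁ : ℝ} (hs : 0 < s)
    (hα₀ : α ≤ α₀) (hα₀1 : α₀ ≤ 1) (hα₁ : α ≤ α₁) (hα₁1 : α₁ ≤ 1) (hsα : s < α)
    (ha : 0 < a) (ha1 : a ≤ 1) (hb : 0 ≤ b) (hba : b * a ^ (α - s) ≤ 1) (hX : 1 ≤ X) (hQ : 0 ≤ Q)
    (hN₀ : 0 ≤ N₀) (hN₁ : 0 ≤ N₁) (h0 : Y 0 ≤ ENNReal.ofReal X)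
    (hsmall : Q * (1 + N₀ + N₁) * X ≤ X ^ s * a ^ s)
    (hstep : ∀ j, Y (j + 1) ^ s ≤ ENNReal.ofReal (Q * b ^ j)
      * (Y j + ENNReal.ofReal N₀ * Y j ^ α₀ + ENNReal.ofReal N₁ * Y j ^ α₁)) (j : ℕ) :
    Y j ≤ ENNReal.ofReal (X * a ^ j) := by
  have hX0 : 0 < X := by linarith
  induction j with
  | zero => simpa using h0
  | succ j ih =>
    have hα0 : 0 < α := hs.trans hsα
    set d := a ^ j with hd
    have hd0 : 0 < d := by positivity
    have hd1 : d ≤ 1 := pow_le_one₀ ha.le ha1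
    -- Since `X ≥ 1` and `d ≤ 1`, all powers that occur have the common bound `X * d ^ α`.
    have hpow : ∀ e, α ≤ e → e ≤ 1 → Y j ^ e ≤ ENNReal.ofReal (X * d ^ α) := by
      intro e h1 h2
      have he : 0 ≤ e := hα0.le.trans h1
      refine (ENNReal.rpow_le_rpow ih he).trans ?_
      rw [ENNReal.ofReal_rpow_of_nonneg (by positivity) he]
      refine ENNReal.ofReal_le_ofReal ?_
      rw [Real.mul_rpow hX0.le hd0.le]
      refine mul_le_mul ?_ ?_ (by positivity) hX0.le
      · calc X ^ e ≤ X ^ (1 : ℝ) := Real.rpow_le_rpow_of_exponent_le hX h2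
          _ = X := Real.rpow_one X
      · exact Real.rpow_le_rpow_of_exponent_ge hd0 hd1 h1
    have h1 : Y j ≤ ENNReal.ofReal (X * d ^ α) := by
      simpa using hpow 1 (hα₀.trans hα₀1) le_rfl
    have h2 : Y (j + 1) ^ s ≤ ENNReal.ofReal ((X * a ^ (j + 1)) ^ s) := by
      refine (hstep j).trans ?_
      calc _ ≤ ENNReal.ofReal (Q * b ^ j) * (ENNReal.ofReal (X * d ^ α)
            + ENNReal.ofReal N₀ * ENNReal.ofReal (X * d ^ α)
            + ENNReal.ofReal N₁ * ENNReal.ofReal (X * d ^ α)) := by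
            gcongr
            · exact hpow _ hα₀ hα₀1
            · exact hpow _ hα₁ hα₁1
        _ = ENNReal.ofReal (Q * b ^ j * ((1 + N₀ + N₁) * (X * d ^ α))) := by
            rw [← ENNReal.ofReal_mul hN₀, ← ENNReal.ofReal_mul hN₁,
              ← ENNReal.ofReal_add (by positivity) (by positivity),
              ← ENNReal.ofReal_add (by positivity) (by positivity),
              ← ENNReal.ofReal_mul (by positivity)]
            congr 1; ring
        _ ≤ _ := by
            refine ENNReal.ofReal_le_ofReal ?_
            -- The surplus `α - s` of the superlinear power pays for the growth `b ^ j`, by the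
            -- choice of `a`.
            have e1 : b ^ j * d ^ α ≤ d ^ s := by
              have : d ^ α = d ^ (α - s) * d ^ s := by
                rw [← Real.rpow_add hd0]; congr 1; ring
              have e2 : d ^ (α - s) = (a ^ (α - s)) ^ j := by
                rw [hd, ← Real.rpow_natCast, ← Real.rpow_natCast, ← Real.rpow_mul ha.le,
                  ← Real.rpow_mul ha.le, mul_comm]
              rw [this, e2, ← mul_assoc, ← mul_pow]
              exact mul_le_of_le_one_left (by positivity) (pow_le_one₀ (by positivity) hba)
            calc Q * b ^ j * ((1 + N₀ + N₁) * (X * d ^ α))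
                = Q * (1 + N₀ + N₁) * X * (b ^ j * d ^ α) := by ring
              _ ≤ X ^ s * a ^ s * d ^ s := by gcongr
              _ = _ := by
                rw [pow_succ, Real.mul_rpow hX0.le (by positivity), Real.mul_rpow hd0.le ha.le]
                ring
    rw [← ENNReal.ofReal_rpow_of_nonneg (by positivity) hs.le] at h2
    exact (ENNReal.rpow_le_rpow_iff hs).1 h2

end

/-! ### The iteration and the local supremum bound. -/

section

open Filter Topology Metric Set
open scoped NNReal

theorem superlevelMass_mono {n : ℕ} {pstar k k' ρ ρ' : ℝ} {u : EuclideanSpace ℝ (Fin n) → ℝ}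
    {x₀ : EuclideanSpace ℝ (Fin n)} (hk : k ≤ k') (hρ : ρ' ≤ ρ) :
    superlevelMass pstar u x₀ k' ρ' ≤ superlevelMass pstar u x₀ k ρ := by
  unfold superlevelMass
  refine (lintegral_mono fun x => ?_).trans (lintegral_mono_set (ball_subset_ball hρ))
  exact indicator_le_indicator_of_subset (fun y hy => hk.trans_lt hy) (fun _ => zero_le) x

theorem superlevelMass_le {n : ℕ} {pstar k ρ : ℝ} (hP : 0 < pstar)
    {u : EuclideanSpace ℝ (Fin n) → ℝ} {x₀ : EuclideanSpace ℝ (Fin n)} :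
    superlevelMass pstar u x₀ k ρ
      ≤ eLpNorm u (ENNReal.ofReal pstar) (volume.restrict (ball x₀ ρ)) ^ pstar := by
  rw [eLpNorm_eq_lintegral_rpow_enorm_toReal (by simpa using hP) ENNReal.ofReal_ne_top,
    ENNReal.toReal_ofReal hP.le, ← ENNReal.rpow_mul, one_div, inv_mul_cancel₀ hP.ne',
    ENNReal.rpow_one]
  exact lintegral_mono fun x => indicator_le_self _ _ x

theorem eLpNorm_top_le_of_superlevelMass_eq_zero {n : ℕ} {pstar k ρ : ℝ}
    {u : EuclideanSpace ℝ (Fin n) → ℝ} {x₀ : EuclideanSpace ℝ (Fin n)} (hk : 0 ≤ k)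
    (hu : AEMeasurable u (volume.restrict (ball x₀ ρ)))
    (h : superlevelMass pstar u x₀ k ρ = 0) :
    eLpNorm u ⊤ (volume.restrict (ball x₀ ρ)) ≤ ENNReal.ofReal k := by
  rw [superlevelMass, lintegral_eq_zero_iff' (aemeasurable_superlevel hu k pstar)] at h
  rw [eLpNorm_exponent_top]
  refine eLpNormEssSup_le_of_ae_bound ?_
  filter_upwards [h] with x hx
  by_contra hlt
  rw [not_le, Real.norm_eq_abs] at hlt
  rw [indicator_of_mem (show x ∈ {y | k < |u y|} from hlt)] at hx
  have h0 : ‖u x‖ₑ ≠ 0 := by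
    rw [enorm_ne_zero]; rintro h0; rw [h0, abs_zero] at hlt; linarith
  exact (ENNReal.rpow_pos (pos_iff_ne_zero.2 h0) enorm_ne_top).ne' hx

set_option maxHeartbeats 1000000 in
/-- The local supremum bound for solutions, with a uniform constant. -/
theorem exists_local_bound_const {n : ℕ} (hn : 0 < n) {p q θ δ s₀ s₁ pstar lam pt : ℝ}
    (h : IterationExponents p q θ δ s₀ s₁ pstar lam) (hpt : 1 ≤ pt) (hptp : pt ≤ p)
    (hps : pstar⁻¹ = pt⁻¹ - (n : ℝ)⁻¹) {c₁ c₂ c₃ c₄ M : ℝ} (hc₁ : 0 < c₁)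
    (hc₂ : 0 < c₂) (hc₃ : 0 < c₃) (hc₄ : 0 < c₄) (hM : 0 < M) {N₀ N₁ : ℝ} (hN₀ : 0 ≤ N₀)
    (hN₁ : 0 ≤ N₁) :
    ∃ c : ℝ, 0 < c ∧ ∀ (Ω : Set (EuclideanSpace ℝ (Fin n)))
      (A : EuclideanSpace ℝ (Fin n) → EuclideanSpace ℝ (Fin n))
      (B b₀ b₁ u : EuclideanSpace ℝ (Fin n) → ℝ)
      (G : EuclideanSpace ℝ (Fin n) → EuclideanSpace ℝ (Fin n)), IsOpen Ω →
      IsStructuredSolution Ω p q θ δ c₁ c₂ c₃ c₄ M A B b₀ b₁ u G →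
      ∀ (x₀ : EuclideanSpace ℝ (Fin n)) (r : ℝ), 0 < r → r ≤ 1 → ball x₀ r ⊆ Ω →
      AEMeasurable b₀ (volume.restrict (ball x₀ r)) →
      AEMeasurable b₁ (volume.restrict (ball x₀ r)) →
      eLpNorm b₀ (ENNReal.ofReal s₀) (volume.restrict (ball x₀ r)) ≤ ENNReal.ofReal N₀ →
      eLpNorm b₁ (ENNReal.ofReal s₁) (volume.restrict (ball x₀ r)) ≤ ENNReal.ofReal N₁ →
      MemLp u (ENNReal.ofReal pstar) (volume.restrict (ball x₀ r)) →
      eLpNorm u ⊤ (volume.restrict (ball x₀ (r / 2)))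
        ≤ ENNReal.ofReal (c / r ^ (p / ((pstar - lam) * (p - q + 1))))
          * (1 + eLpNorm u (ENNReal.ofReal pstar) (volume.restrict (ball x₀ r)))
            ^ ((pstar - p) / (pstar - lam)) := by
  obtain ⟨C, hC, hen⟩ := exists_energy_const hn h hpt hptp hps hc₁ hc₂ hc₃ hc₄ hM
  have hp := h.one_le_p
  have hp0 : 0 < p := by linarith
  have hd : 0 < p - q + 1 := by linarith [h.q_lt]
  have hτ1 : 1 ≤ p / (p - q + 1) := (hp.trans h.p_le_q).trans h.q_le_div
  have hpτ : p ≤ p / (p - q + 1) := h.p_le_q.trans h.q_le_div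
  have hpP : p < pstar := (hpτ.trans h.le_lam).trans_lt h.lam_lt
  have hP0 : 0 < pstar := hp0.trans hpP
  set τ := p / (p - q + 1) with hτ
  set σ := pstar - lam with hσ
  have hσ0 : 0 < σ := sub_pos.2 h.lam_lt
  set s := p / pstar with hs
  have hs0 : 0 < s := by positivity
  set α := min (1 - 1 / s₀) (1 - 1 / s₁) with hα
  have hsα : s < α := by
    rw [hα, lt_min_iff, hs, div_lt_iff₀ hP0, div_lt_iff₀ hP0, mul_comm, mul_comm _ pstar]
    exact ⟨h.lt_s₀, h.lt_s₁⟩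
  -- Chosen so that `2 ^ (p + τ) * a ^ (α - s) = 1`; at each step the level gap contributes the
  -- factor `2 ^ p` and the radius gap `2 ^ τ`.
  set a : ℝ := 2 ^ (-(p + τ) / (α - s)) with ha
  have ha0 : 0 < a := by positivity
  have ha1 : a < 1 := by
    refine Real.rpow_lt_one_of_one_lt_of_neg one_lt_two (div_neg_of_neg_of_pos ?_ ?_) <;> linarith
  have hba : (2 : ℝ) ^ (p + τ) * a ^ (α - s) ≤ 1 := by
    have : α - s ≠ 0 := by linarith
    rw [ha, ← Real.rpow_mul zero_le_two, div_mul_cancel₀ _ this, ← Real.rpow_add zero_lt_two,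
      add_neg_cancel, Real.rpow_zero]
  set D := 16 ^ p * 4 ^ τ * C with hD
  have hD0 : 0 < D := by positivity
  set E := max 1 (D * (1 + N₀ + N₁) / a ^ s) with hE
  have hE1 : 1 ≤ E := le_max_left _ _
  -- The factor `2` reflects that the levels below rise from `K` to `2 * K`.
  refine ⟨2 * E ^ (1 / σ), by positivity, ?_⟩
  intro Ω A B b₀ b₁ u G hΩ hsol x₀ r hr hr1 hball hb₀ hb₁ hbN₀ hbN₁ hu
  set e := eLpNorm u (ENNReal.ofReal pstar) (volume.restrict (ball x₀ r)) with he
  have het : e ≠ ⊤ := hu.2.ne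
  set W := 1 + e.toReal with hW
  have hW1 : 1 ≤ W := by linarith [ENNReal.toReal_nonneg (a := e)]
  have hW0 : 0 < W := by linarith
  have heW : 1 + e = ENNReal.ofReal W := by
    rw [hW, ENNReal.ofReal_add zero_le_one ENNReal.toReal_nonneg, ENNReal.ofReal_one,
      ENNReal.ofReal_toReal het]
  -- `K` comes from solving the smallness condition of `le_geometric_of_superlinear` with `X = W ^
  -- pstar`: since `X ^ s = W ^ p`, it suffices that `K ^ σ` be this multiple of `W ^ (pstar - p)`.
  -- The maximum with `1` in `E` ensures `1 ≤ K`.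
  set K := (E * (r ^ τ)⁻¹ * W ^ (pstar - p)) ^ (1 / σ) with hK
  have hrτ : 0 < r ^ τ := by positivity
  have hK1 : 1 ≤ K := by
    refine Real.one_le_rpow ?_ (by positivity)
    have h1 : 1 ≤ (r ^ τ)⁻¹ := (one_le_inv₀ hrτ).2 (Real.rpow_le_one hr.le hr1 (by linarith))
    have h2 : 1 ≤ W ^ (pstar - p) := Real.one_le_rpow hW1 (by linarith)
    exact one_le_mul_of_one_le_of_one_le (one_le_mul_of_one_le_of_one_le hE1 h1) h2
  have hK0 : 0 < K := by linarith
  have hKσ : K ^ σ = E * (r ^ τ)⁻¹ * W ^ (pstar - p) := by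
    rw [hK, ← Real.rpow_mul (by positivity), one_div, inv_mul_cancel₀ hσ0.ne', Real.rpow_one]
  let k : ℕ → ℝ := fun j => K * (2 - (1 / 2) ^ j)
  let ρ : ℕ → ℝ := fun j => r / 2 * (1 + (1 / 2) ^ j)
  have hhalf : ∀ j : ℕ, (0 : ℝ) < (1 / 2) ^ j ∧ ((1 : ℝ) / 2) ^ j ≤ 1 := fun j =>
    ⟨by positivity, pow_le_one₀ (by norm_num) (by norm_num)⟩
  have hkK : ∀ j, K ≤ k j := fun j => by
    simp only [k]; nlinarith [hhalf j]
  have hk2K : ∀ j, k j ≤ 2 * K := fun j => by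
    simp only [k]; nlinarith [hhalf j]
  have hρr : ∀ j, ρ j ≤ r := fun j => by
    simp only [ρ]; nlinarith [hhalf j]
  have hρr2 : ∀ j, r / 2 ≤ ρ j := fun j => by
    simp only [ρ]; nlinarith [hhalf j]
  have hkd : ∀ j, k (j + 1) - k j = K * (1 / 2) ^ j / 2 := fun j => by
    simp only [k, pow_succ]; ring
  have hρd : ∀ j, ρ j - ρ (j + 1) = r * (1 / 2) ^ j / 4 := fun j => by
    simp only [ρ, pow_succ]; ring
  let Y : ℕ → ℝ≥0∞ := fun j => superlevelMass pstar u x₀ (k j) (ρ j)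
  have hY0 : Y 0 ≤ ENNReal.ofReal (W ^ pstar) := by
    refine (superlevelMass_mono le_rfl (hρr 0)).trans ((superlevelMass_le hP0).trans ?_)
    rw [← ENNReal.ofReal_rpow_of_pos hW0, ← heW]
    exact ENNReal.rpow_le_rpow le_add_self hP0.le
  have hstep : ∀ j, Y (j + 1) ^ s ≤ ENNReal.ofReal (D * (r ^ τ)⁻¹ * (K ^ σ)⁻¹
      * ((2 : ℝ) ^ (p + τ)) ^ j) * (Y j + ENNReal.ofReal N₀ * Y j ^ (1 - 1 / s₀)
        + ENNReal.ofReal N₁ * Y j ^ (1 - 1 / s₁)) := by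
    intro j
    have hjpos := (hhalf j).1
    have hkj : 0 < k j := hK0.trans_le (hkK j)
    have hkj' : 0 < k (j + 1) := hK0.trans_le (hkK _)
    have hρj : 0 < ρ j - ρ (j + 1) := by rw [hρd]; positivity
    have hsub : ball x₀ (ρ j) ⊆ ball x₀ r := ball_subset_ball (hρr j)
    have hres : volume.restrict (ball x₀ (ρ j)) ≤ volume.restrict (ball x₀ r) :=
      Measure.restrict_mono hsub le_rfl
    have h1 := hen Ω A B b₀ b₁ u G hΩ hsol x₀ (ρ (j + 1)) (ρ j) (k j) (k (j + 1))
      ((half_pos hr).trans_le (hρr2 _)) (by linarith) ((hρr j).trans hr1) (hsub.trans hball)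
      (hK1.trans (hkK j)) (by
        have : 0 < K * (1 / 2) ^ j / 2 := by positivity
        linarith [hkd j])
    have h2 := lintegral_superlevelTerm_le h (x₀ := x₀) (ρ := ρ j) (hK1.trans (hkK j))
      (hu.1.aemeasurable.mono_measure hres) (hb₀.mono_measure hres) (hb₁.mono_measure hres)
    have h3 : ENNReal.ofReal (k j ^ (lam - pstar)) ≤ ENNReal.ofReal ((K ^ σ)⁻¹) := by
      refine ENNReal.ofReal_le_ofReal ?_
      rw [← Real.rpow_neg hK0.le, hσ, neg_sub]
      exact Real.rpow_le_rpow_of_nonpos hK0 (hkK j) (by linarith)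
    -- The gap is `K * (1 / 2) ^ j / 2` and the next level is at most `2 * K`; hence the `16 ^ p` in
    -- `D`. Likewise `4 ^ τ` stems from the radius gap `r * (1 / 2) ^ j / 4`.
    have hγ : ((1 : ℝ) / 2) ^ j / 16 ≤ (k (j + 1) - k j) / (4 * k (j + 1)) := by
      rw [hkd, div_le_div_iff₀ (by norm_num) (by positivity)]
      nlinarith [hk2K (j + 1)]
    have hγ0 : (0 : ℝ) < (1 / 2) ^ j / 16 := by positivity
    have hρτ : C / (ρ j - ρ (j + 1)) ^ τ
        = C * 4 ^ τ * (r ^ τ)⁻¹ * (((1 / 2 : ℝ) ^ j) ^ τ)⁻¹ := by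
      rw [hρd, Real.div_rpow (by positivity) (by norm_num), Real.mul_rpow hr.le hjpos.le]
      field_simp
    have h4 : ENNReal.ofReal (((1 / 2 : ℝ) ^ j / 16) ^ p) * Y (j + 1) ^ s
        ≤ ENNReal.ofReal (C * 4 ^ τ * (r ^ τ)⁻¹ * (((1 / 2 : ℝ) ^ j) ^ τ)⁻¹)
          * (ENNReal.ofReal ((K ^ σ)⁻¹) * (Y j + ENNReal.ofReal N₀ * Y j ^ (1 - 1 / s₀)
        + ENNReal.ofReal N₁ * Y j ^ (1 - 1 / s₁))) := by
      calc _ ≤ ENNReal.ofReal ((k (j + 1) - k j) / (4 * k (j + 1))) ^ p * Y (j + 1) ^ s := by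
            rw [← ENNReal.ofReal_rpow_of_pos hγ0]
            gcongr
        _ ≤ _ := h1
        _ ≤ _ := by
          rw [hρτ]
          gcongr
          refine h2.trans ?_
          gcongr
          · exact (eLpNorm_mono_measure _ hres).trans hbN₀
          · exact (eLpNorm_mono_measure _ hres).trans hbN₁
    have hpp : 0 < ((1 / 2 : ℝ) ^ j / 16) ^ p := by positivity
    have h5 : Y (j + 1) ^ s ≤ ENNReal.ofReal ((((1 / 2 : ℝ) ^ j / 16) ^ p)⁻¹)
        * (ENNReal.ofReal (((1 / 2 : ℝ) ^ j / 16) ^ p) * Y (j + 1) ^ s) := by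
      rw [← mul_assoc, ← ENNReal.ofReal_mul (by positivity), inv_mul_cancel₀ hpp.ne',
        ENNReal.ofReal_one, one_mul]
    refine h5.trans ((mul_le_mul_right h4 _).trans (le_of_eq ?_))
    rw [← mul_assoc, ← mul_assoc, ← ENNReal.ofReal_mul (by positivity),
      ← ENNReal.ofReal_mul (by positivity)]
    congr 2
    have e1 : ((2 : ℝ) ^ (p + τ)) ^ j = (((1 / 2 : ℝ) ^ j) ^ p)⁻¹ * (((1 / 2 : ℝ) ^ j) ^ τ)⁻¹ := by
      have e2 : ∀ x : ℝ, (((1 / 2 : ℝ) ^ j) ^ x)⁻¹ = (2 ^ x) ^ j := by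
        intro x
        rw [one_div, inv_pow, Real.inv_rpow (by positivity), inv_inv, ← Real.rpow_natCast,
          ← Real.rpow_natCast, ← Real.rpow_mul zero_le_two, ← Real.rpow_mul zero_le_two, mul_comm]
      rw [e2, e2, ← mul_pow, Real.rpow_add zero_lt_two]
    rw [e1, Real.div_rpow hjpos.le (by norm_num), hD]
    field_simp
  have hα1 : ∀ {t : ℝ}, 1 < t → 1 - 1 / t ≤ 1 := fun {t} ht => by
    have : 0 < 1 / t := one_div_pos.2 (by linarith)
    linarith
  have hgeo := le_geometric_of_superlinear (Y := Y) hs0 (min_le_left _ _) (hα1 h.one_lt_s₀)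
    (min_le_right _ _) (hα1 h.one_lt_s₁) hsα ha0 ha1.le (by positivity) hba
    (Real.one_le_rpow hW1 hP0.le) (by positivity) hN₀ hN₁ hY0 (Q := D * (r ^ τ)⁻¹ * (K ^ σ)⁻¹) (by
      have e1 : (W ^ pstar) ^ s = W ^ p := by
        rw [← Real.rpow_mul hW0.le, hs, mul_div_cancel₀ _ hP0.ne']
      have e2 : W ^ pstar = W ^ p * W ^ (pstar - p) := by
        rw [← Real.rpow_add hW0]; congr 1; ring
      have e3 : D * (1 + N₀ + N₁) ≤ E * a ^ s := by
        rw [← div_le_iff₀ (by positivity)]; exact le_max_right _ _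
      rw [e1, hKσ, e2]
      have : 0 < W ^ (pstar - p) := by positivity
      have hE0 : 0 < E := by linarith
      calc _ = D * (1 + N₀ + N₁) * (W ^ p / E) := by field_simp
        _ ≤ E * a ^ s * (W ^ p / E) := by gcongr
        _ = _ := by field_simp) hstep
  -- This mass is at most every `Y j`, because the levels stay below `2 * K` and the radii above `r
  -- / 2`.
  have hzero : superlevelMass pstar u x₀ (2 * K) (r / 2) = 0 := by
    have ht : Tendsto (fun j : ℕ => ENNReal.ofReal (W ^ pstar * a ^ j)) atTop (𝓝 0) := by
      have := ((tendsto_pow_atTop_nhds_zero_of_lt_one ha0.le ha1).const_mul (W ^ pstar))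
      rw [mul_zero] at this
      simpa using ENNReal.tendsto_ofReal this
    refine le_antisymm (ge_of_tendsto' ht fun j => ?_) zero_le
    exact (superlevelMass_mono (hk2K j) (hρr2 j)).trans (hgeo j)
  have hres : volume.restrict (ball x₀ (r / 2)) ≤ volume.restrict (ball x₀ r) :=
    Measure.restrict_mono (ball_subset_ball (by linarith)) le_rfl
  refine (eLpNorm_top_le_of_superlevelMass_eq_zero (by positivity)
    (hu.1.aemeasurable.mono_measure hres) hzero).trans (le_of_eq ?_)
  rw [heW, ENNReal.ofReal_rpow_of_pos hW0, ← ENNReal.ofReal_mul (by positivity)]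
  congr 1
  have e1 : p / (σ * (p - q + 1)) = τ * (1 / σ) := by rw [hτ]; field_simp
  rw [hK, Real.mul_rpow (by positivity) (by positivity), Real.mul_rpow (by positivity)
    (by positivity), ← Real.rpow_mul hW0.le, Real.inv_rpow (by positivity), ← Real.rpow_mul hr.le,
    e1, mul_one_div (pstar - p)]
  field_simp

end

/-! ### The theorem: uniform estimate and local boundedness. -/

theorem theorem4p2 (n : ℕ) (hn : 2 ≤ n) (p q θ δ s₀ s₁ pstar : ℝ)
    (hexp : AdmissibleExponents n p q θ δ s₀ s₁ pstar)
    (c₁ c₂ c₃ c₄ M : ℝ) (hc₁ : 0 < c₁) (hc₂ : 0 < c₂) (hc₃ : 0 < c₃) (hc₄ : 0 < c₄) (hM : 0 < M) :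
    0 < sigmaExponent p q θ δ s₀ s₁ pstar ∧
    -- every weak solution is locally bounded
    (∀ (Ω : Set (EuclideanSpace ℝ (Fin n)))
      (a : EuclideanSpace ℝ (Fin n) → ℝ → EuclideanSpace ℝ (Fin n) → EuclideanSpace ℝ (Fin n))
      (b : EuclideanSpace ℝ (Fin n) → ℝ → EuclideanSpace ℝ (Fin n) → ℝ)
      (b₀ b₁ u : EuclideanSpace ℝ (Fin n) → ℝ),
      IsOpen Ω → StructureConditions Ω p q θ δ s₀ s₁ c₁ c₂ c₃ c₄ M a b b₀ b₁ →
      IsWeakSolution Ω q a b u → MemLpLoc Ω ∞ u) ∧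
    -- the estimate: apart from `n`, the exponents and `c₁, …, c₄, M`, the constant `c` depends only
    -- on (bounds for) the norms of `b₀` and `b₁` in the ball of radius `R₀`
    ∀ N₀ N₁ : ℝ, ∃ c : ℝ, 0 < c ∧
      ∀ (Ω : Set (EuclideanSpace ℝ (Fin n)))
        (a : EuclideanSpace ℝ (Fin n) → ℝ → EuclideanSpace ℝ (Fin n) → EuclideanSpace ℝ (Fin n))
        (b : EuclideanSpace ℝ (Fin n) → ℝ → EuclideanSpace ℝ (Fin n) → ℝ)
        (b₀ b₁ u : EuclideanSpace ℝ (Fin n) → ℝ),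
        IsOpen Ω → StructureConditions Ω p q θ δ s₀ s₁ c₁ c₂ c₃ c₄ M a b b₀ b₁ →
        IsWeakSolution Ω q a b u →
        ∀ (x₀ : EuclideanSpace ℝ (Fin n)) (R₀ : ℝ), 0 < R₀ → R₀ ≤ 1 →
          Metric.closedBall x₀ R₀ ⊆ Ω →
          eLpNorm b₀ (ENNReal.ofReal s₀) (volume.restrict (Metric.ball x₀ R₀))
            ≤ ENNReal.ofReal N₀ →
          eLpNorm b₁ (ENNReal.ofReal s₁) (volume.restrict (Metric.ball x₀ R₀))
            ≤ ENNReal.ofReal N₁ →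
          ∀ r : ℝ, 0 < r → r ≤ R₀ →
            MemLp u (ENNReal.ofReal pstar) (volume.restrict (Metric.ball x₀ r)) ∧
            eLpNorm u ∞ (volume.restrict (Metric.ball x₀ (r / 2))) ≤
              ENNReal.ofReal
                (c / r ^ (p / (sigmaExponent p q θ δ s₀ s₁ pstar * (p - q + 1)))) *
              (1 + eLpNorm u (ENNReal.ofReal pstar) (volume.restrict (Metric.ball x₀ r))) ^
                ((pstar - p) / sigmaExponent p q θ δ s₀ s₁ pstar) := by
  have hn0 : 0 < n := by omega
  have h := hexp.iterationExponents
  obtain ⟨pt, hpt, hptp, hps⟩ := hexp.exists_sobolev_exponent hn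
  have hP0 : 0 < pstar := by linarith [hexp.one_le_p, hexp.p_lt_pstar]
  have hσ : 0 < sigmaExponent p q θ δ s₀ s₁ pstar := by linarith [h.lam_lt]
  have hmem : ∀ {Ω : Set (EuclideanSpace ℝ (Fin n))}
      {b : EuclideanSpace ℝ (Fin n) → ℝ} {s : ℝ≥0∞}, MemLpLoc Ω s b →
      ∀ {x₀ : EuclideanSpace ℝ (Fin n)} {r : ℝ}, Metric.closedBall x₀ r ⊆ Ω →
      MemLp b s (volume.restrict (Metric.ball x₀ r)) := fun hb x₀ r hr =>
    (hb _ (isCompact_closedBall x₀ r) hr).mono_measure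
      (Measure.restrict_mono Metric.ball_subset_closedBall le_rfl)
  have main : ∀ N₀ N₁ : ℝ, ∃ c : ℝ, 0 < c ∧
      ∀ (Ω : Set (EuclideanSpace ℝ (Fin n)))
        (a : EuclideanSpace ℝ (Fin n) → ℝ → EuclideanSpace ℝ (Fin n) → EuclideanSpace ℝ (Fin n))
        (b : EuclideanSpace ℝ (Fin n) → ℝ → EuclideanSpace ℝ (Fin n) → ℝ)
        (b₀ b₁ u : EuclideanSpace ℝ (Fin n) → ℝ),
        IsOpen Ω → StructureConditions Ω p q θ δ s₀ s₁ c₁ c₂ c₃ c₄ M a b b₀ b₁ →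
        IsWeakSolution Ω q a b u →
        ∀ (x₀ : EuclideanSpace ℝ (Fin n)) (R₀ : ℝ), 0 < R₀ → R₀ ≤ 1 →
          Metric.closedBall x₀ R₀ ⊆ Ω →
          eLpNorm b₀ (ENNReal.ofReal s₀) (volume.restrict (Metric.ball x₀ R₀))
            ≤ ENNReal.ofReal N₀ →
          eLpNorm b₁ (ENNReal.ofReal s₁) (volume.restrict (Metric.ball x₀ R₀))
            ≤ ENNReal.ofReal N₁ →
          ∀ r : ℝ, 0 < r → r ≤ R₀ →
            MemLp u (ENNReal.ofReal pstar) (volume.restrict (Metric.ball x₀ r)) ∧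
            eLpNorm u ∞ (volume.restrict (Metric.ball x₀ (r / 2))) ≤
              ENNReal.ofReal
                (c / r ^ (p / (sigmaExponent p q θ δ s₀ s₁ pstar * (p - q + 1)))) *
              (1 + eLpNorm u (ENNReal.ofReal pstar) (volume.restrict (Metric.ball x₀ r))) ^
                ((pstar - p) / sigmaExponent p q θ δ s₀ s₁ pstar) := by
    intro N₀ N₁
    -- `ENNReal.ofReal` sends negative numbers to `0`, so the bounds may be replaced by their maxima
    -- with `0`.
    obtain ⟨c, hc, hbound⟩ := exists_local_bound_const hn0 h hpt hptp hps hc₁ hc₂ hc₃ hc₄ hM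
      (le_max_right N₀ 0) (le_max_right N₁ 0)
    refine ⟨c, hc, ?_⟩
    intro Ω a b b₀ b₁ u hΩ hstr hsol x₀ R₀ hR₀ hR₀1 hball hN₀ hN₁ r hr hrR
    obtain ⟨A, B, G, hs⟩ := hsol.exists_isStructuredSolution hstr
    have hrball : Metric.closedBall x₀ r ⊆ Ω := (Metric.closedBall_subset_closedBall hrR).trans hball
    have hres : volume.restrict (Metric.ball x₀ r) ≤ volume.restrict (Metric.ball x₀ R₀) :=
      Measure.restrict_mono (Metric.ball_subset_ball hrR) le_rfl
    have hu : MemLp u (ENNReal.ofReal pstar) (volume.restrict (Metric.ball x₀ r)) :=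
      (hs.memW1Loc.memLp_of_isCompact hn0 hΩ hpt (hptp.trans hexp.p_le_q) hP0 hps
        (isCompact_closedBall x₀ r) hrball).mono_measure
          (Measure.restrict_mono Metric.ball_subset_closedBall le_rfl)
    refine ⟨hu, ?_⟩
    have := hbound Ω A B b₀ b₁ u G hΩ hs x₀ r hr (hrR.trans hR₀1)
      (Metric.ball_subset_closedBall.trans hrball) (hmem hstr.b₀_memLp hrball).1.aemeasurable
      (hmem hstr.b₁_memLp hrball).1.aemeasurable
      ((eLpNorm_mono_measure _ hres).trans
        (hN₀.trans (ENNReal.ofReal_le_ofReal (le_max_left _ _))))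
      ((eLpNorm_mono_measure _ hres).trans
        (hN₁.trans (ENNReal.ofReal_le_ofReal (le_max_left _ _)))) hu
    rwa [sub_sub_cancel] at this
  refine ⟨hσ, ?_, main⟩
  intro Ω a b b₀ b₁ u hΩ hstr hsol K hK hKΩ
  -- Qualitative boundedness follows from the estimate on small balls, with the actual norms of `b₀`
  -- and `b₁` as bounds; compactness passes from balls to `K`.
  have hloc : ∀ x ∈ K, ∃ t ∈ nhdsWithin x K, MemLp u ∞ (volume.restrict t) := by
    intro x hx
    obtain ⟨ε, hε, hball⟩ := Metric.nhds_basis_closedBall.mem_iff.1 (hΩ.mem_nhds (hKΩ hx))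
    set R := min ε 1 with hR
    have hR0 : 0 < R := lt_min hε one_pos
    have hRΩ : Metric.closedBall x R ⊆ Ω :=
      (Metric.closedBall_subset_closedBall (min_le_left _ _)).trans hball
    have hb₀ := (hmem hstr.b₀_memLp hRΩ).2.ne
    have hb₁ := (hmem hstr.b₁_memLp hRΩ).2.ne
    obtain ⟨c, -, hbound⟩ := main
      (eLpNorm b₀ (ENNReal.ofReal s₀) (volume.restrict (Metric.ball x R))).toReal
      (eLpNorm b₁ (ENNReal.ofReal s₁) (volume.restrict (Metric.ball x R))).toReal
    obtain ⟨hu, hle⟩ := hbound Ω a b b₀ b₁ u hΩ hstr hsol x R hR0 (min_le_right _ _) hRΩ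
      (ENNReal.ofReal_toReal hb₀).ge (ENNReal.ofReal_toReal hb₁).ge R hR0 le_rfl
    refine ⟨Metric.ball x (R / 2), mem_nhdsWithin_of_mem_nhds (Metric.ball_mem_nhds x (half_pos hR0)),
      hu.1.mono_measure
        (Measure.restrict_mono (Metric.ball_subset_ball (half_le_self hR0.le)) le_rfl), ?_⟩
    refine hle.trans_lt (ENNReal.mul_lt_top ENNReal.ofReal_lt_top ?_)
    exact ENNReal.rpow_lt_top_of_nonneg
      (div_nonneg (by linarith [hexp.p_lt_pstar]) hσ.le) (by simp [hu.2.ne])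
  refine hK.induction_on (p := fun t => MemLp u ∞ (volume.restrict t)) ?_ ?_ ?_ hloc
  · simp
  · exact fun s t hst ht => ht.mono_measure (Measure.restrict_mono hst le_rfl)
  · intro s t hs ht
    refine ⟨aestronglyMeasurable_union_iff.2 ⟨hs.1, ht.1⟩, ?_⟩
    rw [eLpNorm_exponent_top]
    refine lt_of_le_of_lt (essSup_le_of_ae_le (max (eLpNorm u ∞ (volume.restrict s))
      (eLpNorm u ∞ (volume.restrict t))) ?_) (max_lt hs.2 ht.2)
    refine (ae_restrict_union_iff s t _).2 ⟨?_, ?_⟩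
    · filter_upwards [ae_le_eLpNormEssSup (f := u) (μ := volume.restrict s)] with x hx
      exact le_max_of_le_left hx
    · filter_upwards [ae_le_eLpNormEssSup (f := u) (μ := volume.restrict t)] with x hx
      exact le_max_of_le_right hx
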